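/- Proposition. Let $(U_t)_{t\in\mathbb Z}$ and $(X_t)_{t\in\mathbb Z}$ be processes on a probability space with values in $\mathbb R^2$ and $\mathbb R^m$ respectively, and let $\mathcal F_t=\sigma((U_s,X_s):s\le t)$. Assume: (A1) the process $((U_t,X_t))_{t\in\mathbb Z}$ is stationary and ergodic, and for every $t\in\mathbb Z$ the vector $U_t$ is independent of $\mathcal F_{t-1}$; moreover both coordinates of $U_t$ are uniformly distributed on $[0,1]$ (that is, the law of $U_t$ is a copula), and $X_1$ is integrable. Let $F_\epsilon^{-1}(u)=\inf\{x\in\mathbb R: F_\epsilon(x)\ge u\}$, where $F_\epsilon$ is the distribution function of a random variable $\epsilon$ with mean $0$ and variance $1$. Let $d\in\mathbb R_+^2$, let $A,B$ be $2\times 2$ matrices with nonnegative entries, and let $\Gamma$ be a real $2\times m$ matrix such that for every $t$, almost surely, both coordinates of $\Gamma X_t$ are nonnegative (for instance, $\Gamma$ and $X_t$ have nonnegative entries). Consider the GAIN (GARCH/INGARCH) model, in which $Y_t=(Y_{1,t},Y_{2,t})\in\mathbb R\times\mathbb N$, $\lambda_t=(\lambda_{1,t},\lambda_{2,t})\in\mathbb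 R_+^2$ and, almost surely, for all $t\in\mathbb Z$, $$Y_{1,t}=\lambda_{1,t}^{1/2}F_\epsilon^{-1}(U_{1,t}),\qquad Y_{2,t}=\inf\Big\{y\in\mathbb N:\ \sum_{j=0}^{y}e^{-\lambda_{2,t}}\frac{\lambda_{2,t}^j}{j!}\ge U_{2,t}\Big\},$$ $$\lambda_t=d+B\lambda_{t-1}+A\overline Y_{t-1}+\Gamma X_{t-1},\qquad \overline Y_t=(Y_{1,t}^2,Y_{2,t})'.$$ Let $\rho$ denote the spectral radius. 1. If $\rho(A+B)<1$, there exists a solution $((Y_t,\lambda_t))_{t\in\mathbb Z}$ of the model which is a stationary, $(\mathcal F_t)_{t\in\mathbb Z}$-adapted and integrable process, and it is unique up to almost sure equality. Moreover, the process $((Y_t,\lambda_t,X_t))_{t\in\mathbb Z}$ is stationary and ergodic. 2. Conversely, if both coordinates of $d$ are positive and there exists a solution $((Y_t,\lambda_t))_{t\in\mathbb Z}$ of the model which is a stationary, $(\mathcal F_t)_{t\in\mathbb Z}$-adapted and integrable process, then $\rho(A+B)<1$. -/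

import Mathlib

open MeasureTheory ProbabilityTheory

namespace GAIN

/-- The time shift on two-sided sequences. -/
def shift {S : Type*} (z : ℤ → S) : ℤ → S := fun t => z (t + 1)

/-- The law, on the space of two-sided sequences, of the process `Z`. -/
noncomputable def pathLaw {Ω S : Type*} [MeasurableSpace Ω] [MeasurableSpace S]
    (P : Measure Ω) (Z : ℤ → Ω → S) : Measure (ℤ → S) :=
  P.map (fun ω t => Z t ω)

/-- (Strict) stationarity: the law of the process is invariant under the time shift. -/
def IsStationary {Ω S : Type*} [MeasurableSpace Ω] [MeasurableSpace S]
    (P : Measure Ω) (Z : ℤ → Ω → S) : Prop :=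
  (∀ t, AEMeasurable (Z t) P) ∧
    MeasurePreserving shift (pathLaw P Z) (pathLaw P Z)

/-- Stationarity and ergodicity: the time shift is an ergodic transformation (in particular
it preserves the measure) for the law of the process. -/
def IsStationaryErgodic {Ω S : Type*} [MeasurableSpace Ω] [MeasurableSpace S]
    (P : Measure Ω) (Z : ℤ → Ω → S) : Prop :=
  (∀ t, AEMeasurable (Z t) P) ∧ Ergodic shift (pathLaw P Z)

/-- A copula on `[0,1]^k`: all one-dimensional marginals are uniform on `[0,1]`. -/
def IsCopula {k : ℕ} (C : Measure (Fin k → ℝ)) : Prop :=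
  ∀ i, C.map (fun u => u i) = volume.restrict (Set.Icc (0 : ℝ) 1)

/-- `ℱ_t = σ((U_s, X_s) : s ≤ t)`. -/
noncomputable def inputFiltration {Ω : Type*} [MeasurableSpace Ω] {m : ℕ}
    (U : ℤ → Ω → Fin 2 → ℝ) (X : ℤ → Ω → Fin m → ℝ)
    (hU : ∀ t, Measurable (U t)) (hX : ∀ t, Measurable (X t)) :
    Filtration ℤ ‹MeasurableSpace Ω› :=
  Filtration.natural (fun t ω => (U t ω, X t ω))
    (fun t => ((hU t).prodMk (hX t)).stronglyMeasurable)

/-- Assumption on the inputs: `(U_t, X_t)` is stationary and ergodic, and `U_t` is independent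
of `ℱ_{t-1}` for every `t`. -/
def AssumptionA1 {Ω : Type*} [MeasurableSpace Ω] {m : ℕ} (P : Measure Ω)
    (U : ℤ → Ω → Fin 2 → ℝ) (X : ℤ → Ω → Fin m → ℝ)
    (hU : ∀ t, Measurable (U t)) (hX : ∀ t, Measurable (X t)) : Prop :=
  IsStationaryErgodic P (fun t ω => (U t ω, X t ω)) ∧
    ∀ t, Indep (MeasurableSpace.comap (U t) inferInstance)
      (inputFiltration U X hU hX (t - 1)) P

/-- The generalized inverse `u ↦ inf {x : F(x) ≥ u}` of the distribution function `F` of `ν`;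
only its values for `0 < u < 1` matter. -/
noncomputable def cdfInverse (ν : Measure ℝ) (u : ℝ) : ℝ :=
  sInf {x : ℝ | u ≤ cdf ν x}

/-- The generalized inverse at `u` of the distribution function of the Poisson law with
parameter `s ≥ 0`; only its values for `u < 1` matter. -/
noncomputable def poissonInverse (s u : ℝ) : ℕ :=
  sInf {y : ℕ | u ≤ ∑ j ∈ Finset.range (y + 1), Real.exp (-s) * s ^ j / (j.factorial : ℝ)}

/-- `(y₁, y₂) ↦ (y₁², y₂)`. -/
def obsTransform (y : ℝ × ℕ) : Fin 2 → ℝ := ![y.1 ^ 2, (y.2 : ℝ)]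

/-- `(Y, lam)` solves the model equations almost surely, with nonnegative latent process. -/
structure IsSolution {Ω : Type*} [MeasurableSpace Ω] {m : ℕ} (P : Measure Ω) (ν : Measure ℝ)
    (d : Fin 2 → ℝ) (A B : Matrix (Fin 2) (Fin 2) ℝ) (Γ : Matrix (Fin 2) (Fin m) ℝ)
    (U : ℤ → Ω → Fin 2 → ℝ) (X : ℤ → Ω → Fin m → ℝ)
    (Y : ℤ → Ω → ℝ × ℕ) (lam : ℤ → Ω → Fin 2 → ℝ) : Prop where
  latent_nonneg : ∀ᵐ ω ∂P, ∀ t i, 0 ≤ lam t ω i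
  garch : ∀ᵐ ω ∂P, ∀ t, (Y t ω).1 = √(lam t ω 0) * cdfInverse ν (U t ω 0)
  ingarch : ∀ᵐ ω ∂P, ∀ t, (Y t ω).2 = poissonInverse (lam t ω 1) (U t ω 1)
  latent : ∀ᵐ ω ∂P, ∀ t, lam t ω = d + B.mulVec (lam (t - 1) ω)
    + A.mulVec (obsTransform (Y (t - 1) ω)) + Γ.mulVec (X (t - 1) ω)

/-- `(Y, lam)` is a solution of the model and a stationary, adapted and integrable process. -/
structure IsStationaryIntegrableSolution {Ω : Type*} [MeasurableSpace Ω] {m : ℕ}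
    (P : Measure Ω) (ν : Measure ℝ)
    (d : Fin 2 → ℝ) (A B : Matrix (Fin 2) (Fin 2) ℝ) (Γ : Matrix (Fin 2) (Fin m) ℝ)
    (U : ℤ → Ω → Fin 2 → ℝ) (X : ℤ → Ω → Fin m → ℝ)
    (hU : ∀ t, Measurable (U t)) (hX : ∀ t, Measurable (X t))
    (Y : ℤ → Ω → ℝ × ℕ) (lam : ℤ → Ω → Fin 2 → ℝ) : Prop where
  solution : IsSolution P ν d A B Γ U X Y lam
  stationary : IsStationary P (fun t ω => (Y t ω, lam t ω))
  adapted : Adapted (inputFiltration U X hU hX) (fun t ω => (Y t ω, lam t ω))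
  integrable_fst : ∀ t, Integrable (fun ω => (Y t ω).1) P
  integrable_snd : ∀ t, Integrable (fun ω => ((Y t ω).2 : ℝ)) P
  integrable_latent : ∀ t i, Integrable (fun ω => lam t ω i) P

/-- The spectral radius of a real square matrix: the largest modulus of its complex
eigenvalues. -/
noncomputable def matrixSpectralRadius {k : ℕ} (M : Matrix (Fin k) (Fin k) ℝ) : ENNReal :=
  spectralRadius ℂ (M.map (fun x : ℝ => (x : ℂ)))

end GAIN

namespace GAIN

open Set Filter Topology

/-! The quantile transforms turn an innovation `u` with uniform coordinates, independent of a
nonnegative integrable state `l`, into an observation whose transform (squared first coordinate,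
second coordinate) has the same mean as `l`: given `l`, the first coordinate is centred with
variance `l 0`, the second is Poisson with mean `l 1`. Hence one step of the recursion acts on means
by the affine map `x ↦ g + (A + B) x`, with `g = d + Γ E[X 1]`. For `u < 1` the step is also
nondecreasing in the nonnegative state and continuous along limits from below.

Existence: the recursion started from `0` at time `t - n` gives a sequence nondecreasing in `n`
(`approx_mono`), whose means are iterates of the affine map and converge when the spectral radius is
below one. Monotone convergence makes the limit integrable (`lintegral_iSup_approx`), continuity
from below makes it a solution (`latentLimit_eq_step`), and, being a function of the input path that
commutes with the shift, it inherits ergodicity.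

Uniqueness: every nonnegative solution dominates the approximations, hence their limit. Both means
solve the same affine equation, which has one solution, and ordered variables with equal means agree
almost surely (`ae_solution_eq_limit`).

Converse: the mean `x` of a solution satisfies `x = g + (A + B) x` with `g > 0`, so `A + B` strictly
decreases a positive vector, which forces its spectral radius below one. -/

/-! ### Quantile function of the innovation law -/

theorem cdfInverse_le_iff {ν : Measure ℝ} {u : ℝ} (hu : u ∈ Ioo (0 : ℝ) 1) (x : ℝ) :
    cdfInverse ν u ≤ x ↔ u ≤ cdf ν x := by
  have hne : {x : ℝ | u ≤ cdf ν x}.Nonempty :=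
    ((tendsto_cdf_atTop ν).eventually (eventually_ge_nhds hu.2)).exists
  have hbdd : BddBelow {x : ℝ | u ≤ cdf ν x} := by
    obtain ⟨b, hb⟩ := ((tendsto_cdf_atBot ν).eventually (eventually_lt_nhds hu.1)).exists
    refine ⟨b, fun y hy => ?_⟩
    by_contra! h
    exact absurd (hy.trans (monotone_cdf ν h.le)) (not_le.2 hb)
  refine ⟨fun h => ?_, fun h => csInf_le hbdd h⟩
  have hgt : ∀ y, x < y → u ≤ cdf ν y := fun y hy => by
    obtain ⟨z, hz, hzy⟩ := (csInf_lt_iff hbdd hne).1 (h.trans_lt hy)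
    exact le_trans hz (monotone_cdf ν hzy.le)
  -- Right continuity of the distribution function makes the infimum attained.
  have hc : Tendsto (cdf ν) (𝓝[>] x) (𝓝 (cdf ν x)) :=
    ((cdf ν).right_continuous x).mono_left (nhdsWithin_mono _ Ioi_subset_Ici_self)
  exact ge_of_tendsto hc (eventually_mem_nhdsWithin.mono fun y hy => hgt y hy)

/-- Outside `(0, 1]` the defining set is the whole line or empty, and `sInf` takes its default value
`0` on both; this settles measurability there. -/
theorem cdfInverse_of_nonpos {ν : Measure ℝ} {u : ℝ} (hu : u ≤ 0) : cdfInverse ν u = 0 := by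
  have : {x : ℝ | u ≤ cdf ν x} = univ := by
    ext x; simpa using hu.trans (cdf_nonneg ν x)
  rw [cdfInverse, this, Real.sInf_univ]

theorem cdfInverse_of_one_lt {ν : Measure ℝ} {u : ℝ} (hu : 1 < u) : cdfInverse ν u = 0 := by
  have : {x : ℝ | u ≤ cdf ν x} = ∅ := by
    ext x; simpa using (cdf_le_one ν x).trans_lt hu
  rw [cdfInverse, this, Real.sInf_empty]

theorem measurable_cdfInverse (ν : Measure ℝ) : Measurable (cdfInverse ν) := by
  refine measurable_of_Iic fun x => ?_
  -- The point `1` is split off: its value depends on whether the distribution function reaches `1`,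
  -- but a singleton is measurable in any case.
  have h : cdfInverse ν ⁻¹' Iic x = (Ioo 0 1 ∩ Iic (cdf ν x)) ∪
      ((Iic 0 ∪ Ioi 1) ∩ {_u : ℝ | (0 : ℝ) ≤ x}) ∪ ({1} ∩ {_u : ℝ | cdfInverse ν 1 ≤ x}) := by
    ext u
    simp only [mem_preimage, mem_Iic, mem_union, mem_inter_iff, mem_Ioi, mem_singleton_iff,
      mem_ofPred_eq]
    rcases le_or_gt u 0 with h0 | h0
    · rw [cdfInverse_of_nonpos h0]
      have : ¬ u = 1 := by linarith
      have : u ∉ Ioo (0 : ℝ) 1 := fun h => by linarith [h.1]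
      simp [*]
    · rcases lt_trichotomy u 1 with h1 | h1 | h1
      · rw [cdfInverse_le_iff ⟨h0, h1⟩]
        have : ¬ u = 1 := h1.ne
        simp [*, h1.not_gt]
      · subst h1
        simp
      · rw [cdfInverse_of_one_lt h1]
        have : ¬ u = 1 := h1.ne'
        have : u ∉ Ioo (0 : ℝ) 1 := fun h => by linarith [h.2]
        simp [*]
  rw [h]
  exact ((measurableSet_Ioo.inter measurableSet_Iic).union
    ((measurableSet_Iic.union measurableSet_Ioi).inter (MeasurableSet.const _))).union
    ((measurableSet_singleton _).inter (MeasurableSet.const _))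

theorem ae_mem_Ioo_uniform :
    ∀ᵐ u ∂(volume.restrict (Icc (0 : ℝ) 1)), u ∈ Ioo (0 : ℝ) 1 := by
  rw [← restrict_Ioo_eq_restrict_Icc]
  exact ae_restrict_mem measurableSet_Ioo

instance isProbabilityMeasure_uniform :
    IsProbabilityMeasure (volume.restrict (Icc (0 : ℝ) 1)) := ⟨by simp⟩

theorem uniform_setOf_le {p : ℝ} (hp1 : p ≤ 1) :
    (volume.restrict (Icc (0 : ℝ) 1)) {u | u ≤ p} = ENNReal.ofReal p := by
  change (volume.restrict (Icc (0 : ℝ) 1)) (Iic p) = _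
  rw [Measure.restrict_apply measurableSet_Iic]
  have : Iic p ∩ Icc (0 : ℝ) 1 = Icc 0 p := by
    ext u; simp only [mem_inter_iff, mem_Iic, mem_Icc]
    exact ⟨fun h => ⟨h.2.1, h.1⟩, fun h => ⟨h.2, h.1, h.2.trans hp1⟩⟩
  rw [this, Real.volume_Icc, sub_zero]

/-- The quantile transformation: the generalized inverse maps the uniform law to `ν`. -/
theorem map_cdfInverse (ν : Measure ℝ) [IsProbabilityMeasure ν] :
    (volume.restrict (Icc (0 : ℝ) 1)).map (cdfInverse ν) = ν := by
  have : IsProbabilityMeasure ((volume.restrict (Icc (0 : ℝ) 1)).map (cdfInverse ν)) :=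
    Measure.isProbabilityMeasure_map (measurable_cdfInverse ν).aemeasurable
  refine Measure.ext_of_Iic _ _ fun x => ?_
  rw [Measure.map_apply (measurable_cdfInverse ν) measurableSet_Iic, ← ofReal_cdf ν x,
    ← uniform_setOf_le (cdf_le_one ν x)]
  refine measure_congr ?_
  filter_upwards [ae_mem_Ioo_uniform] with u hu
  exact propext (cdfInverse_le_iff hu x)

theorem lintegral_sq_cdfInverse (ν : Measure ℝ) [IsProbabilityMeasure ν] (hν : MemLp id 2 ν)
    (hmean : ∫ x, x ∂ν = 0) (hvar : Var[id; ν] = 1) :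
    ∫⁻ u in Icc (0 : ℝ) 1, ENNReal.ofReal (cdfInverse ν u ^ 2) = 1 := by
  have hm : Measurable fun x : ℝ => ENNReal.ofReal (x ^ 2) := by fun_prop
  rw [← lintegral_map (f := fun x : ℝ => ENNReal.ofReal (x ^ 2)) hm (measurable_cdfInverse ν),
    map_cdfInverse]
  have h := ofReal_integral_eq_lintegral_ofReal hν.integrable_sq (ae_of_all _ fun x => sq_nonneg _)
  simp only [id] at h
  rw [← h]
  rw [variance_of_integral_eq_zero measurable_id.aemeasurable hmean] at hvar
  simp only [id] at hvar
  rw [hvar, ENNReal.ofReal_one]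

/-! ### Poisson quantile function -/

/-- The distribution function of the Poisson law with parameter `s` at the integer `k`. -/
noncomputable def poissonCdf (s : ℝ) (k : ℕ) : ℝ :=
  ∑ j ∈ Finset.range (k + 1), Real.exp (-s) * s ^ j / (j.factorial : ℝ)

theorem continuous_poissonCdf (k : ℕ) : Continuous fun s => poissonCdf s k := by
  unfold poissonCdf
  fun_prop

/-- The derivative of the sum telescopes, so only its last term survives. -/
theorem hasDerivAt_poissonCdf (s : ℝ) (k : ℕ) :
    HasDerivAt (fun s => poissonCdf s k) (-(Real.exp (-s) * s ^ k / (k.factorial : ℝ))) s := by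
  have hE : HasDerivAt (fun s : ℝ => Real.exp (-s)) (-Real.exp (-s)) s := by
    simpa using (hasDerivAt_neg s).exp
  induction k with
  | zero => simpa [poissonCdf] using hE
  | succ k ih =>
    have h1 := (hE.mul (hasDerivAt_pow (k + 1) s)).div_const ((k + 1).factorial : ℝ)
    have h := ih.add h1
    have hfun : (fun s => poissonCdf s (k + 1)) = fun s => poissonCdf s k +
        Real.exp (-s) * s ^ (k + 1) / ((k + 1).factorial : ℝ) := by
      funext s; exact Finset.sum_range_succ _ _
    rw [hfun]
    refine h.congr_deriv ?_
    have hk : (k.factorial : ℝ) ≠ 0 := by positivity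
    have hk' : (k + 1 : ℝ) ≠ 0 := by positivity
    rw [Nat.factorial_succ]
    push_cast
    field_simp
    ring

theorem poissonCdf_antitoneOn (k : ℕ) : AntitoneOn (fun s => poissonCdf s k) (Ici 0) := by
  refine antitoneOn_of_deriv_nonpos (convex_Ici 0) (continuous_poissonCdf k).continuousOn
    (fun s _ => (hasDerivAt_poissonCdf s k).differentiableAt.differentiableWithinAt) fun s hs => ?_
  rw [interior_Ici] at hs
  have hs' : (0 : ℝ) < s := hs
  rw [(hasDerivAt_poissonCdf s k).deriv, neg_nonpos]
  positivity

theorem poissonCdf_mono {s : ℝ} (hs : 0 ≤ s) : Monotone (poissonCdf s) := fun a b h =>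
  Finset.sum_le_sum_of_subset_of_nonneg (Finset.range_mono (by omega)) fun _ _ _ => by positivity

theorem tendsto_poissonCdf {s : ℝ} (hs : 0 ≤ s) : Tendsto (poissonCdf s) atTop (𝓝 1) :=
  ((hasSum_one_poissonMeasure ⟨s, hs⟩).tendsto_sum_nat).comp (tendsto_add_atTop_nat 1)

theorem poissonCdf_le_one {s : ℝ} (hs : 0 ≤ s) (k : ℕ) : poissonCdf s k ≤ 1 :=
  (poissonCdf_mono hs).ge_of_tendsto (tendsto_poissonCdf hs) k

theorem poissonInverse_le_iff {s u : ℝ} (hs : 0 ≤ s) (hu : u < 1) (k : ℕ) :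
    poissonInverse s u ≤ k ↔ u ≤ poissonCdf s k := by
  have hne : {y : ℕ | u ≤ poissonCdf s y}.Nonempty :=
    ((tendsto_poissonCdf hs).eventually (eventually_ge_nhds hu)).exists
  refine ⟨fun h => ?_, fun h => Nat.sInf_le h⟩
  exact le_trans (Nat.sInf_mem hne) (poissonCdf_mono hs h)

theorem poissonInverse_mono {s t u : ℝ} (hs : 0 ≤ s) (hst : s ≤ t) (hu : u < 1) :
    poissonInverse s u ≤ poissonInverse t u := by
  rw [poissonInverse_le_iff hs hu]
  exact ((poissonInverse_le_iff (hs.trans hst) hu _).1 le_rfl).trans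
    (poissonCdf_antitoneOn _ hs (hs.trans hst) hst)

/-- Left continuity in the parameter. Monotonicity bounds the values by the one at `l`; exceeding
its predecessor is an open condition on the parameter, and the values are integers. -/
theorem eventually_poissonInverse_eq {s : ℕ → ℝ} {l u : ℝ} (hs : ∀ n, 0 ≤ s n)
    (hsl : ∀ n, s n ≤ l) (hlim : Tendsto s atTop (𝓝 l)) (hu : u < 1) :
    ∀ᶠ n in atTop, poissonInverse (s n) u = poissonInverse l u := by
  have hl : 0 ≤ l := (hs 0).trans (hsl 0)
  rcases Nat.eq_zero_or_pos (poissonInverse l u) with h0 | h0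
  · refine Eventually.of_forall fun n => ?_
    have := poissonInverse_mono (hs n) (hsl n) hu
    omega
  · have h : poissonCdf l (poissonInverse l u - 1) < u := by
      rw [← not_le, ← poissonInverse_le_iff hl hu]
      omega
    have hc := ((continuous_poissonCdf (poissonInverse l u - 1)).tendsto l).comp hlim
    filter_upwards [hc.eventually (eventually_lt_nhds h)] with n hn
    have h1 := poissonInverse_mono (hs n) (hsl n) hu
    have h2 : ¬ poissonInverse (s n) u ≤ poissonInverse l u - 1 := by
      rw [poissonInverse_le_iff (hs n) hu]
      exact not_le.2 hn
    omega

theorem measurable_poissonInverse :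
    Measurable fun p : ℝ × ℝ => poissonInverse p.1 p.2 := by
  have hle : ∀ k, MeasurableSet {p : ℝ × ℝ | p.2 ≤ poissonCdf p.1 k} := fun k =>
    measurableSet_le measurable_snd ((continuous_poissonCdf k).measurable.comp measurable_fst)
  refine measurable_of_Iic fun k => ?_
  -- The last set is where no integer qualifies, so that `sInf ∅ = 0` is at most `k`.
  have h : (fun p : ℝ × ℝ => poissonInverse p.1 p.2) ⁻¹' Iic k =
      (⋃ j ∈ Iic k, {p : ℝ × ℝ | p.2 ≤ poissonCdf p.1 j}) ∪
        ⋂ j, {p : ℝ × ℝ | p.2 ≤ poissonCdf p.1 j}ᶜ := by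
    ext p
    simp only [mem_preimage, mem_Iic, mem_union, mem_iUnion, mem_iInter, mem_compl_iff,
      mem_ofPred_eq, exists_prop]
    change sInf {y : ℕ | p.2 ≤ poissonCdf p.1 y} ≤ k ↔ _
    constructor
    · intro hk
      by_cases hne : {y : ℕ | p.2 ≤ poissonCdf p.1 y}.Nonempty
      · exact Or.inl ⟨_, hk, Nat.sInf_mem hne⟩
      · exact Or.inr fun j hj => hne ⟨j, hj⟩
    · rintro (⟨j, hj, hp⟩ | hp)
      · exact (Nat.sInf_le hp).trans hj
      · rw [show {y : ℕ | p.2 ≤ poissonCdf p.1 y} = ∅ from eq_empty_of_forall_notMem hp,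
          Nat.sInf_empty]
        exact Nat.zero_le _
  rw [h]
  exact (MeasurableSet.biUnion (to_countable _) fun j _ => hle j).union
    (MeasurableSet.iInter fun j => (hle j).compl)

theorem map_poissonInverse (r : NNReal) :
    (volume.restrict (Icc (0 : ℝ) 1)).map (poissonInverse r) = poissonMeasure r := by
  have hs : (0 : ℝ) ≤ r := r.coe_nonneg
  have hm : Measurable (poissonInverse r) := measurable_poissonInverse.comp measurable_prodMk_left
  have : IsProbabilityMeasure ((volume.restrict (Icc (0 : ℝ) 1)).map (poissonInverse r)) :=
    Measure.isProbabilityMeasure_map hm.aemeasurable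
  refine Measure.ext_of_Iic _ _ fun k => ?_
  rw [Measure.map_apply hm measurableSet_Iic]
  have h1 : poissonMeasure r (Iic k) = ENNReal.ofReal (poissonCdf r k) := by
    have : (Iic k : Set ℕ) = ↑(Finset.range (k + 1)) := by ext; simp
    rw [this, ← sum_measure_singleton, poissonCdf,
      ENNReal.ofReal_sum_of_nonneg fun _ _ => by positivity]
    exact Finset.sum_congr rfl fun j _ => poissonMeasure_singleton _ _
  rw [h1, ← uniform_setOf_le (poissonCdf_le_one hs k)]
  refine measure_congr ?_
  filter_upwards [ae_mem_Ioo_uniform] with u hu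
  exact propext (poissonInverse_le_iff hs hu.2 k)

/-- The weights satisfy `(n + 1) p (n + 1) = r p n`, so the mean is `r` times the total mass. -/
theorem lintegral_natCast_poissonMeasure (r : NNReal) :
    ∫⁻ n : ℕ, (n : ENNReal) ∂(poissonMeasure r) = r := by
  rw [lintegral_countable', tsum_eq_zero_add' ENNReal.summable]
  have h : ∀ n : ℕ, ((n + 1 : ℕ) : ENNReal) * poissonMeasure r {n + 1}
      = r * poissonMeasure r {n} := fun n => by
    rw [poissonMeasure_singleton, poissonMeasure_singleton, ← ENNReal.ofReal_natCast,
      ← ENNReal.ofReal_coe_nnreal, ← ENNReal.ofReal_mul (by positivity),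
      ← ENNReal.ofReal_mul (by positivity), Nat.factorial_succ]
    congr 1
    push_cast
    have hk : (n.factorial : ℝ) ≠ 0 := by positivity
    have hk' : (n + 1 : ℝ) ≠ 0 := by positivity
    field_simp
    ring
  simp_rw [h]
  rw [ENNReal.tsum_mul_left]
  have : ∑' n, poissonMeasure r {n} = 1 := by
    have := lintegral_countable' (μ := poissonMeasure r) (fun _ => 1)
    simpa using this.symm
  rw [this]
  simp

theorem lintegral_poissonInverse {s : ℝ} (hs : 0 ≤ s) :
    ∫⁻ u in Icc (0 : ℝ) 1, (poissonInverse s u : ENNReal) = ENNReal.ofReal s := by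
  lift s to NNReal using hs
  have hm : Measurable (poissonInverse s) := measurable_poissonInverse.comp measurable_prodMk_left
  rw [← lintegral_map (f := fun n : ℕ => (n : ENNReal)) (measurable_of_countable _) hm,
    map_poissonInverse, lintegral_natCast_poissonMeasure, ENNReal.ofReal_coe_nnreal]

/-! ### Spectral radius and powers of matrices -/

section SpectralRadius

attribute [local instance] Matrix.linftyOpNormedRing Matrix.linftyOpNormedAlgebra
  Matrix.linftyOpNormedAddCommGroup

/-- By Gelfand's formula, `‖a ^ n‖ ≤ r ^ n` eventually, for any `r` strictly between the spectral
radius and `1`. -/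
theorem tendsto_pow_of_spectralRadius_lt_one {R : Type*} [NormedRing R] [NormedAlgebra ℂ R]
    [CompleteSpace R] {a : R} (ha : spectralRadius ℂ a < 1) :
    Tendsto (fun n : ℕ => a ^ n) atTop (𝓝 0) := by
  obtain ⟨r, har, hr1⟩ := ENNReal.lt_iff_exists_nnreal_btwn.1 ha
  have hr : r < 1 := by exact_mod_cast hr1
  have h := (spectrum.pow_nnnorm_pow_one_div_tendsto_nhds_spectralRadius a).eventually
    (eventually_lt_nhds har)
  rw [tendsto_zero_iff_norm_tendsto_zero]
  refine squeeze_zero' (Eventually.of_forall fun n => norm_nonneg _) ?_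
    (tendsto_pow_atTop_nhds_zero_of_lt_one r.coe_nonneg hr)
  filter_upwards [h, eventually_gt_atTop 0] with n hn hn0
  have hn' : (0 : ℝ) < n := by exact_mod_cast hn0
  have h2 := ENNReal.rpow_le_rpow hn.le hn'.le
  rw [← ENNReal.rpow_mul, one_div_mul_cancel hn'.ne', ENNReal.rpow_one, ENNReal.rpow_natCast] at h2
  have h3 : ‖a ^ n‖₊ ≤ r ^ n := by exact_mod_cast h2
  exact_mod_cast h3

theorem tendsto_pow_mulVec {k : ℕ} {M : Matrix (Fin k) (Fin k) ℝ}
    (hM : matrixSpectralRadius M < 1) (x : Fin k → ℝ) :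
    Tendsto (fun n : ℕ => (M ^ n).mulVec x) atTop (𝓝 0) := by
  have h := tendsto_pow_of_spectralRadius_lt_one hM
  have hentry : ∀ i j, Tendsto (fun n : ℕ => (M ^ n) i j) atTop (𝓝 0) := by
    intro i j
    have h1 : Tendsto (fun n : ℕ => ((M.map (fun x : ℝ => (x : ℂ))) ^ n) i j) atTop (𝓝 0) := by
      have hc : Continuous fun N : Matrix (Fin k) (Fin k) ℂ => N i j :=
        continuous_apply_apply i j
      exact (hc.tendsto 0).comp h
    have h2 := (Complex.continuous_re.tendsto 0).comp h1
    refine (h2.congr fun n => ?_)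
    have : M.map (fun x : ℝ => (x : ℂ)) = Complex.ofRealHom.mapMatrix M := rfl
    rw [Function.comp_apply, this, ← map_pow]
    simp
  rw [tendsto_pi_nhds]
  intro i
  have := tendsto_finsetSum Finset.univ fun j _ => (hentry i j).mul_const (x j)
  simpa [Matrix.mulVec, dotProduct] using this

/-- A nonnegative matrix which strictly decreases a positive vector has spectral radius less
than one. -/
theorem matrixSpectralRadius_lt_one_of_mulVec_lt {k : ℕ} [NeZero k] {M : Matrix (Fin k) (Fin k) ℝ}
    (hM : ∀ i j, 0 ≤ M i j) {x : Fin k → ℝ} (hx : ∀ i, 0 < x i)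
    (hlt : ∀ i, M.mulVec x i < x i) : matrixSpectralRadius M < 1 := by
  have : Nontrivial (Matrix (Fin k) (Fin k) ℂ) := inferInstance
  rw [matrixSpectralRadius, ← ENNReal.coe_one]
  refine spectrum.spectralRadius_lt_of_forall_lt _ fun z hz => ?_
  rw [← Matrix.spectrum_toLin', ← Module.End.hasEigenvalue_iff_mem_spectrum] at hz
  obtain ⟨v, hv⟩ := hz.exists_hasEigenvector
  have hv0 := hv.2
  have hveq : ∀ i, ∑ j, (M i j : ℂ) * v j = z * v i := fun i => by
    have := congrFun hv.apply_eq_smul i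
    simpa [Matrix.toLin'_apply, Matrix.mulVec, dotProduct] using this
  -- Collatz–Wielandt argument: evaluate the eigenvalue equation where the eigenvector attains its
  -- sup norm weighted by `x`; there `|z| |v i|` is at most `(|v i| / x i) (M x) i < |v i|`.
  obtain ⟨i, -, hi⟩ := Finset.exists_max_image Finset.univ (fun i => ‖v i‖ / x i)
    ⟨0, Finset.mem_univ _⟩
  have hpos : 0 < ‖v i‖ := by
    obtain ⟨j, hj⟩ := Function.ne_iff.1 hv0
    have h1 : 0 < ‖v j‖ / x j := div_pos (norm_pos_iff.2 hj) (hx j)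
    have h2 := h1.trans_le (hi j (Finset.mem_univ _))
    by_contra! h
    have h3 : ‖v i‖ / x i ≤ 0 := div_nonpos_of_nonpos_of_nonneg h (hx i).le
    linarith
  have hbound : ‖z‖ * ‖v i‖ ≤ (‖v i‖ / x i) * M.mulVec x i := by
    rw [← norm_mul, ← hveq i]
    refine (norm_sum_le _ _).trans ?_
    rw [Matrix.mulVec, dotProduct, Finset.mul_sum]
    refine Finset.sum_le_sum fun j _ => ?_
    have h1 : ‖v j‖ ≤ (‖v i‖ / x i) * x j := (div_le_iff₀ (hx j)).1 (hi j (Finset.mem_univ _))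
    rw [norm_mul, Complex.norm_real, Real.norm_of_nonneg (hM i j)]
    calc M i j * ‖v j‖ ≤ M i j * ((‖v i‖ / x i) * x j) := mul_le_mul_of_nonneg_left h1 (hM i j)
      _ = _ := by ring
  have hstrict : (‖v i‖ / x i) * M.mulVec x i < 1 * ‖v i‖ := by
    calc (‖v i‖ / x i) * M.mulVec x i < (‖v i‖ / x i) * x i :=
          mul_lt_mul_of_pos_left (hlt i) (div_pos hpos (hx i))
      _ = 1 * ‖v i‖ := by rw [one_mul, div_mul_cancel₀ _ (hx i).ne']
  have : ‖z‖ < 1 := lt_of_mul_lt_mul_right (hbound.trans_lt hstrict) hpos.le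
  exact_mod_cast this

end SpectralRadius

/-! ### Affine recursions with a contracting matrix -/

theorem eq_zero_of_mulVec_eq {k : ℕ} {M : Matrix (Fin k) (Fin k) ℝ}
    (hM : matrixSpectralRadius M < 1) {x : Fin k → ℝ} (hx : M.mulVec x = x) : x = 0 := by
  have h : ∀ n : ℕ, (M ^ n).mulVec x = x := fun n => by
    induction n with
    | zero => simp
    | succ n ih => rw [pow_succ, ← Matrix.mulVec_mulVec, hx, ih]
  have := tendsto_pow_mulVec hM x
  simp_rw [h] at this
  exact tendsto_nhds_unique tendsto_const_nhds this

theorem eq_of_affine_fixed {k : ℕ} {M : Matrix (Fin k) (Fin k) ℝ}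
    (hM : matrixSpectralRadius M < 1) {g x y : Fin k → ℝ} (hx : x = g + M.mulVec x)
    (hy : y = g + M.mulVec y) : x = y := by
  refine sub_eq_zero.1 (eq_zero_of_mulVec_eq hM ?_)
  rw [Matrix.mulVec_sub]
  conv_rhs => rw [hx, hy]
  abel

/-- `1 - M` has trivial kernel, hence is onto in finite dimension. -/
theorem exists_affine_fixed {k : ℕ} {M : Matrix (Fin k) (Fin k) ℝ}
    (hM : matrixSpectralRadius M < 1) (g : Fin k → ℝ) : ∃ w, w = g + M.mulVec w := by
  have hinj : Function.Injective (Matrix.toLin' (1 - M)) := by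
    rw [injective_iff_map_eq_zero]
    intro x hx
    rw [Matrix.toLin'_apply, Matrix.sub_mulVec, Matrix.one_mulVec, sub_eq_zero] at hx
    exact eq_zero_of_mulVec_eq hM hx.symm
  obtain ⟨w, hw⟩ := LinearMap.injective_iff_surjective.1 hinj g
  rw [Matrix.toLin'_apply, Matrix.sub_mulVec, Matrix.one_mulVec] at hw
  exact ⟨w, by rw [← hw]; abel⟩

theorem tendsto_affine_iterate {k : ℕ} {M : Matrix (Fin k) (Fin k) ℝ}
    (hM : matrixSpectralRadius M < 1) {g w : Fin k → ℝ} (hw : w = g + M.mulVec w)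
    {v : ℕ → Fin k → ℝ} (hv : ∀ n, v (n + 1) = g + M.mulVec (v n)) :
    Tendsto v atTop (𝓝 w) := by
  have h : ∀ n, v n = (M ^ n).mulVec (v 0 - w) + w := fun n => by
    induction n with
    | zero => simp
    | succ n ih =>
      have h1 : v (n + 1) = M.mulVec ((M ^ n).mulVec (v 0 - w)) + (g + M.mulVec w) := by
        rw [hv, ih, Matrix.mulVec_add]
        abel
      rw [h1, ← hw, pow_succ', Matrix.mulVec_mulVec]
  have := (tendsto_pow_mulVec hM (v 0 - w)).add_const w
  rw [zero_add] at this
  exact this.congr fun n => (h n).symm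

/-! ### One step of the recursion: measurability, monotonicity, continuity from below -/

/-- The observation produced by the latent state `l` and the innovation `u`. -/
noncomputable def obs (ν : Measure ℝ) (l u : Fin 2 → ℝ) : ℝ × ℕ :=
  (√(l 0) * cdfInverse ν (u 0), poissonInverse (l 1) (u 1))

/-- The latent state that follows the state `l` when the input is `(u, x)`. -/
noncomputable def step {m : ℕ} (ν : Measure ℝ) (d : Fin 2 → ℝ) (A B : Matrix (Fin 2) (Fin 2) ℝ)
    (Γ : Matrix (Fin 2) (Fin m) ℝ) (z : (Fin 2 → ℝ) × (Fin m → ℝ)) (l : Fin 2 → ℝ) : Fin 2 → ℝ :=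
  d + B.mulVec l + A.mulVec (obsTransform (obs ν l z.1)) + Γ.mulVec z.2

theorem measurable_obs (ν : Measure ℝ) :
    Measurable fun p : (Fin 2 → ℝ) × (Fin 2 → ℝ) => obs ν p.1 p.2 := by
  have h := measurable_cdfInverse ν
  have h' := measurable_poissonInverse
  refine Measurable.prodMk ?_ ?_
  · exact (Real.continuous_sqrt.measurable.comp (by fun_prop)).mul (h.comp (by fun_prop))
  · exact h'.comp (f := fun p : (Fin 2 → ℝ) × (Fin 2 → ℝ) => (p.1 1, p.2 1)) (by fun_prop)

theorem measurable_obsTransform : Measurable obsTransform := by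
  refine measurable_pi_lambda _ fun i => ?_
  fin_cases i
  · exact measurable_fst.pow_const 2
  · exact (measurable_of_countable (fun n : ℕ => (n : ℝ))).comp measurable_snd

theorem measurable_mulVec {n k : ℕ} (N : Matrix (Fin n) (Fin k) ℝ) : Measurable N.mulVec :=
  (Continuous.matrix_mulVec continuous_const continuous_id).measurable

theorem measurable_step {m : ℕ} (ν : Measure ℝ) (d : Fin 2 → ℝ) (A B : Matrix (Fin 2) (Fin 2) ℝ)
    (Γ : Matrix (Fin 2) (Fin m) ℝ) :
    Measurable fun p : ((Fin 2 → ℝ) × (Fin m → ℝ)) × (Fin 2 → ℝ) => step ν d A B Γ p.1 p.2 := by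
  refine ((measurable_const.add ((measurable_mulVec B).comp measurable_snd)).add
    ((measurable_mulVec A).comp (measurable_obsTransform.comp
      ((measurable_obs ν).comp (measurable_snd.prodMk measurable_fst.fst))))).add
    ((measurable_mulVec Γ).comp measurable_fst.snd)

theorem obsTransform_nonneg (y : ℝ × ℕ) (i : Fin 2) : 0 ≤ obsTransform y i := by
  fin_cases i
  · exact sq_nonneg _
  · exact Nat.cast_nonneg _

theorem obsTransform_obs_zero {ν : Measure ℝ} {l u : Fin 2 → ℝ} (hl : 0 ≤ l 0) :
    obsTransform (obs ν l u) 0 = l 0 * cdfInverse ν (u 0) ^ 2 := by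
  change (√(l 0) * cdfInverse ν (u 0)) ^ 2 = _
  rw [mul_pow, Real.sq_sqrt hl]

theorem obsTransform_obs_one (ν : Measure ℝ) (l u : Fin 2 → ℝ) :
    obsTransform (obs ν l u) 1 = (poissonInverse (l 1) (u 1) : ℝ) := rfl

theorem obsTransform_obs_mono {ν : Measure ℝ} {l l' u : Fin 2 → ℝ} (hl : ∀ i, 0 ≤ l i)
    (hll : ∀ i, l i ≤ l' i) (hu : ∀ i, u i < 1) (i : Fin 2) :
    obsTransform (obs ν l u) i ≤ obsTransform (obs ν l' u) i := by
  fin_cases i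
  · change obsTransform (obs ν l u) 0 ≤ obsTransform (obs ν l' u) 0
    rw [obsTransform_obs_zero (hl 0), obsTransform_obs_zero ((hl 0).trans (hll 0))]
    exact mul_le_mul_of_nonneg_right (hll 0) (sq_nonneg _)
  · change obsTransform (obs ν l u) 1 ≤ obsTransform (obs ν l' u) 1
    rw [obsTransform_obs_one, obsTransform_obs_one]
    exact_mod_cast poissonInverse_mono (hl 1) (hll 1) (hu 1)

theorem mulVec_mono {n k : ℕ} {N : Matrix (Fin n) (Fin k) ℝ} (hN : ∀ i j, 0 ≤ N i j)
    {x y : Fin k → ℝ} (h : ∀ j, x j ≤ y j) (i : Fin n) : N.mulVec x i ≤ N.mulVec y i := by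
  simp only [Matrix.mulVec, dotProduct]
  exact Finset.sum_le_sum fun j _ => mul_le_mul_of_nonneg_left (h j) (hN i j)

theorem mulVec_nonneg {n k : ℕ} {N : Matrix (Fin n) (Fin k) ℝ} (hN : ∀ i j, 0 ≤ N i j)
    {x : Fin k → ℝ} (h : ∀ j, 0 ≤ x j) (i : Fin n) : 0 ≤ N.mulVec x i := by
  simp only [Matrix.mulVec, dotProduct]
  exact Finset.sum_nonneg fun j _ => mul_nonneg (hN i j) (h j)

section Step

variable {m : ℕ} {ν : Measure ℝ} {d : Fin 2 → ℝ} {A B : Matrix (Fin 2) (Fin 2) ℝ}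
  {Γ : Matrix (Fin 2) (Fin m) ℝ}

theorem step_nonneg (hd : ∀ i, 0 ≤ d i) (hA : ∀ i j, 0 ≤ A i j) (hB : ∀ i j, 0 ≤ B i j)
    {z : (Fin 2 → ℝ) × (Fin m → ℝ)} (hz : ∀ i, 0 ≤ Γ.mulVec z.2 i) {l : Fin 2 → ℝ}
    (hl : ∀ i, 0 ≤ l i) (i : Fin 2) : 0 ≤ step ν d A B Γ z l i :=
  add_nonneg (add_nonneg (add_nonneg (hd i) (mulVec_nonneg hB hl i))
    (mulVec_nonneg hA (obsTransform_nonneg _) i)) (hz i)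

theorem step_mono (hA : ∀ i j, 0 ≤ A i j) (hB : ∀ i j, 0 ≤ B i j)
    {z : (Fin 2 → ℝ) × (Fin m → ℝ)} (hz : ∀ i, z.1 i < 1) {l l' : Fin 2 → ℝ}
    (hl : ∀ i, 0 ≤ l i) (hll : ∀ i, l i ≤ l' i) (i : Fin 2) :
    step ν d A B Γ z l i ≤ step ν d A B Γ z l' i :=
  add_le_add (add_le_add (add_le_add le_rfl (mulVec_mono hB hll i))
    (mulVec_mono hA (obsTransform_obs_mono hl hll hz) i)) le_rfl

/-- The bound `l n ≤ l'` matters: the Poisson quantile jumps as a function of its parameter and is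
continuous only from the left. -/
theorem tendsto_obsTransform_obs {l : ℕ → Fin 2 → ℝ} {l' u : Fin 2 → ℝ}
    (hl : ∀ n i, 0 ≤ l n i) (hll : ∀ n i, l n i ≤ l' i) (hlim : Tendsto l atTop (𝓝 l'))
    (hu : ∀ i, u i < 1) :
    Tendsto (fun n => obsTransform (obs ν (l n) u)) atTop (𝓝 (obsTransform (obs ν l' u))) := by
  rw [tendsto_pi_nhds] at hlim ⊢
  intro i
  fin_cases i
  · change Tendsto (fun n => obsTransform (obs ν (l n) u) 0) atTop (𝓝 (obsTransform (obs ν l' u) 0))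
    rw [obsTransform_obs_zero ((hl 0 0).trans (hll 0 0))]
    simp_rw [obsTransform_obs_zero (hl _ 0)]
    exact (hlim 0).mul_const _
  · change Tendsto (fun n => obsTransform (obs ν (l n) u) 1) atTop (𝓝 (obsTransform (obs ν l' u) 1))
    simp_rw [obsTransform_obs_one]
    refine tendsto_const_nhds.congr' ?_
    filter_upwards [eventually_poissonInverse_eq (fun n => hl n 1) (fun n => hll n 1) (hlim 1)
      (hu 1)] with n hn
    rw [hn]

theorem tendsto_step {l : ℕ → Fin 2 → ℝ} {l' : Fin 2 → ℝ} {z : (Fin 2 → ℝ) × (Fin m → ℝ)}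
    (hl : ∀ n i, 0 ≤ l n i) (hll : ∀ n i, l n i ≤ l' i) (hlim : Tendsto l atTop (𝓝 l'))
    (hu : ∀ i, z.1 i < 1) :
    Tendsto (fun n => step ν d A B Γ z (l n)) atTop (𝓝 (step ν d A B Γ z l')) := by
  have hc : ∀ N : Matrix (Fin 2) (Fin 2) ℝ, Continuous N.mulVec := fun N =>
    Continuous.matrix_mulVec continuous_const continuous_id
  exact ((tendsto_const_nhds.add (((hc B).tendsto _).comp hlim)).add
    (((hc A).tendsto _).comp (tendsto_obsTransform_obs hl hll hlim hu))).add tendsto_const_nhds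

end Step

/-! ### Expectations under one step -/

section Mean

variable {Ω : Type*} [MeasurableSpace Ω] {P : Measure Ω}

/-- The vector of expectations of a random vector. -/
noncomputable def mean {k : ℕ} (P : Measure Ω) (L : Ω → Fin k → ℝ) : Fin k → ℝ :=
  fun i => ∫ ω, L ω i ∂P

theorem integrable_mulVec {n k : ℕ} (N : Matrix (Fin n) (Fin k) ℝ) {L : Ω → Fin k → ℝ}
    (hL : ∀ i, Integrable (fun ω => L ω i) P) (i : Fin n) :
    Integrable (fun ω => N.mulVec (L ω) i) P := by
  simp only [Matrix.mulVec, dotProduct]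
  exact integrable_finsetSum _ fun j _ => (hL j).const_mul (N i j)

theorem mean_mulVec {n k : ℕ} (N : Matrix (Fin n) (Fin k) ℝ) {L : Ω → Fin k → ℝ}
    (hL : ∀ i, Integrable (fun ω => L ω i) P) :
    mean P (fun ω => N.mulVec (L ω)) = N.mulVec (mean P L) := by
  funext i
  simp only [mean, Matrix.mulVec, dotProduct]
  rw [integral_finsetSum _ fun j _ => (hL j).const_mul (N i j)]
  simp_rw [integral_const_mul]

variable [IsProbabilityMeasure P] {ν : Measure ℝ} [IsProbabilityMeasure ν]

theorem lintegral_obsTransform_obs_uniform (hν : MemLp id 2 ν) (hν_mean : ∫ x, x ∂ν = 0)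
    (hν_var : Var[id; ν] = 1) {C : Measure (Fin 2 → ℝ)} (hC : IsCopula C) {l : Fin 2 → ℝ}
    (hl : ∀ i, 0 ≤ l i) (i : Fin 2) :
    ∫⁻ u, ENNReal.ofReal (obsTransform (obs ν l u) i) ∂C = ENNReal.ofReal (l i) := by
  fin_cases i
  · change ∫⁻ u, ENNReal.ofReal (obsTransform (obs ν l u) 0) ∂C = ENNReal.ofReal (l 0)
    simp_rw [obsTransform_obs_zero (hl 0), ENNReal.ofReal_mul (hl 0)]
    have hm : Measurable fun x => ENNReal.ofReal (cdfInverse ν x ^ 2) :=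
      ((measurable_cdfInverse ν).pow_const 2).ennreal_ofReal
    have hm' : Measurable fun u : Fin 2 → ℝ => ENNReal.ofReal (cdfInverse ν (u 0) ^ 2) :=
      hm.comp (measurable_pi_apply 0)
    rw [lintegral_const_mul _ hm',
      ← lintegral_map (f := fun x => ENNReal.ofReal (cdfInverse ν x ^ 2)) hm
      (measurable_pi_apply 0), hC 0, lintegral_sq_cdfInverse ν hν hν_mean hν_var, mul_one]
  · change ∫⁻ u, ENNReal.ofReal (obsTransform (obs ν l u) 1) ∂C = ENNReal.ofReal (l 1)
    simp_rw [obsTransform_obs_one, ENNReal.ofReal_natCast]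
    have hm : Measurable fun x => (poissonInverse (l 1) x : ENNReal) :=
      (measurable_of_countable _).comp (measurable_poissonInverse.comp measurable_prodMk_left)
    rw [← lintegral_map (f := fun x => (poissonInverse (l 1) x : ENNReal)) hm
      (measurable_pi_apply 1), hC 1, lintegral_poissonInverse (hl 1)]

/-- Independence makes the joint law a product, so Fubini reduces to a fixed state. Lower integrals
require no prior integrability, which is then a consequence. -/
theorem lintegral_obsTransform_obs (hν : MemLp id 2 ν) (hν_mean : ∫ x, x ∂ν = 0)
    (hν_var : Var[id; ν] = 1) {L V : Ω → Fin 2 → ℝ} (hL : AEMeasurable L P) (hV : Measurable V)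
    (hC : IsCopula (P.map V)) (hLV : IndepFun L V P) (hL0 : ∀ᵐ ω ∂P, ∀ i, 0 ≤ L ω i) (i : Fin 2) :
    ∫⁻ ω, ENNReal.ofReal (obsTransform (obs ν (L ω) (V ω)) i) ∂P
      = ∫⁻ ω, ENNReal.ofReal (L ω i) ∂P := by
  have hm : Measurable fun p : (Fin 2 → ℝ) × (Fin 2 → ℝ) =>
      ENNReal.ofReal (obsTransform (obs ν p.1 p.2) i) :=
    ((measurable_pi_apply i).comp (measurable_obsTransform.comp (measurable_obs ν))).ennreal_ofReal
  have : IsProbabilityMeasure (P.map V) := Measure.isProbabilityMeasure_map hV.aemeasurable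
  have h0 : ∀ᵐ l ∂(P.map L), ∀ i, 0 ≤ l i :=
    (ae_map_iff hL (by
      simp only [ofPred_forall]
      exact MeasurableSet.iInter fun i => measurableSet_le measurable_const
        (measurable_pi_apply i))).2 hL0
  rw [← lintegral_map' (f := fun p : (Fin 2 → ℝ) × (Fin 2 → ℝ) =>
      ENNReal.ofReal (obsTransform (obs ν p.1 p.2) i)) hm.aemeasurable
      (hL.prodMk hV.aemeasurable),
    (indepFun_iff_map_prod_eq_prod_map_map hL hV.aemeasurable).1 hLV,
    lintegral_prod _ hm.aemeasurable,
    ← lintegral_map' (f := fun l : Fin 2 → ℝ => ENNReal.ofReal (l i))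
      (measurable_pi_apply i).ennreal_ofReal.aemeasurable hL]
  refine lintegral_congr_ae ?_
  filter_upwards [h0] with l hl
  exact lintegral_obsTransform_obs_uniform hν hν_mean hν_var hC hl i

theorem integrable_and_mean_obsTransform (hν : MemLp id 2 ν) (hν_mean : ∫ x, x ∂ν = 0)
    (hν_var : Var[id; ν] = 1) {L V : Ω → Fin 2 → ℝ} (hL : AEMeasurable L P) (hV : Measurable V)
    (hC : IsCopula (P.map V)) (hLV : IndepFun L V P) (hL0 : ∀ᵐ ω ∂P, ∀ i, 0 ≤ L ω i)
    (hLi : ∀ i, Integrable (fun ω => L ω i) P) :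
    (∀ i, Integrable (fun ω => obsTransform (obs ν (L ω) (V ω)) i) P) ∧
      mean P (fun ω => obsTransform (obs ν (L ω) (V ω))) = mean P L := by
  have hm : ∀ i, AEMeasurable (fun ω => obsTransform (obs ν (L ω) (V ω)) i) P := fun i =>
    ((measurable_pi_apply i).comp (measurable_obsTransform.comp
      (measurable_obs ν))).comp_aemeasurable (hL.prodMk hV.aemeasurable)
  have key := lintegral_obsTransform_obs hν hν_mean hν_var hL hV hC hLV hL0
  refine ⟨fun i => ?_, funext fun i => ?_⟩
  · refine (lintegral_ofReal_ne_top_iff_integrable (hm i).aestronglyMeasurable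
      (ae_of_all _ fun ω => obsTransform_nonneg _ i)).1 ?_
    rw [key i]
    exact (lintegral_ofReal_ne_top_iff_integrable (hLi i).aestronglyMeasurable
      (hL0.mono fun ω h => h i)).2 (hLi i)
  · rw [mean, mean, integral_eq_lintegral_of_nonneg_ae (ae_of_all _ fun ω =>
      obsTransform_nonneg _ i) (hm i).aestronglyMeasurable, key i,
      integral_eq_lintegral_of_nonneg_ae (hL0.mono fun ω h => h i) (hLi i).aestronglyMeasurable]

/-- The expectation of the next latent state is an affine function of the expectation of the
present one. -/
theorem integrable_and_mean_step {m : ℕ} (d : Fin 2 → ℝ) (A B : Matrix (Fin 2) (Fin 2) ℝ)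
    (Γ : Matrix (Fin 2) (Fin m) ℝ) (hν : MemLp id 2 ν) (hν_mean : ∫ x, x ∂ν = 0)
    (hν_var : Var[id; ν] = 1) {L V : Ω → Fin 2 → ℝ} {W : Ω → Fin m → ℝ} (hL : AEMeasurable L P)
    (hV : Measurable V) (hC : IsCopula (P.map V)) (hLV : IndepFun L V P)
    (hL0 : ∀ᵐ ω ∂P, ∀ i, 0 ≤ L ω i) (hLi : ∀ i, Integrable (fun ω => L ω i) P)
    (hW : ∀ j, Integrable (fun ω => W ω j) P) :
    (∀ i, Integrable (fun ω => step ν d A B Γ (V ω, W ω) (L ω) i) P) ∧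
      mean P (fun ω => step ν d A B Γ (V ω, W ω) (L ω)) =
        (d + Γ.mulVec (mean P W)) + (A + B).mulVec (mean P L) := by
  obtain ⟨hO, hOm⟩ := integrable_and_mean_obsTransform hν hν_mean hν_var hL hV hC hLV hL0 hLi
  have h1 := fun i => integrable_mulVec B hLi i
  have h2 := fun i => integrable_mulVec A hO i
  have h3 := fun i => integrable_mulVec Γ hW i
  have h0 : ∀ i, Integrable (fun _ : Ω => d i) P := fun i => integrable_const _
  refine ⟨fun i => (((h0 i).add (h1 i)).add (h2 i)).add (h3 i), funext fun i => ?_⟩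
  have e1 := congrFun (mean_mulVec B hLi) i
  have e2 := congrFun (mean_mulVec A hO) i
  have e3 := congrFun (mean_mulVec Γ hW) i
  rw [hOm] at e2
  simp only [Matrix.add_mulVec, Pi.add_apply, ← e1, ← e2, ← e3, mean, step]
  have s1 := integral_add (((h0 i).add (h1 i)).add (h2 i)) (h3 i)
  have s2 := integral_add ((h0 i).add (h1 i)) (h2 i)
  have s3 := integral_add (h0 i) (h1 i)
  simp only [Pi.add_apply, integral_const, probReal_univ, one_smul] at s1 s2 s3
  rw [s1, s2, s3]
  ring

end Mean

/-! ### Pathwise construction from the remote past -/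

section Construction

variable {m : ℕ} (ν : Measure ℝ) (d : Fin 2 → ℝ) (A B : Matrix (Fin 2) (Fin 2) ℝ)
  (Γ : Matrix (Fin 2) (Fin m) ℝ)

/-- The latent process obtained along the input `z` by starting from `0` at time `t - n`. -/
noncomputable def approx : ℕ → (ℤ → (Fin 2 → ℝ) × (Fin m → ℝ)) → ℤ → Fin 2 → ℝ
  | 0, _, _ => 0
  | n + 1, z, t => step ν d A B Γ (z (t - 1)) (approx n z (t - 1))

/-- The limit of the approximations started in the remote past. -/
noncomputable def latentLimit (z : ℤ → (Fin 2 → ℝ) × (Fin m → ℝ)) (t : ℤ) : Fin 2 → ℝ :=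
  fun i => (⨆ n, ENNReal.ofReal (approx ν d A B Γ n z t i)).toReal

/-- The observations driven by the limit latent process. -/
noncomputable def obsLimit (z : ℤ → (Fin 2 → ℝ) × (Fin m → ℝ)) (t : ℤ) : ℝ × ℕ :=
  obs ν (latentLimit ν d A B Γ z t) (z t).1

theorem approx_shift (n : ℕ) (z : ℤ → (Fin 2 → ℝ) × (Fin m → ℝ)) (t : ℤ) :
    approx ν d A B Γ n (shift z) t = approx ν d A B Γ n z (t + 1) := by
  induction n generalizing t with
  | zero => rfl
  | succ n ih =>
    rw [approx, approx, ih, shift, sub_add_cancel, add_sub_cancel_right]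

theorem latentLimit_shift (z : ℤ → (Fin 2 → ℝ) × (Fin m → ℝ)) (t : ℤ) :
    latentLimit ν d A B Γ (shift z) t = latentLimit ν d A B Γ z (t + 1) := by
  funext i
  simp only [latentLimit, approx_shift]

theorem measurable_step_comp {Ω : Type*} {mΩ : MeasurableSpace Ω}
    {Z : Ω → (Fin 2 → ℝ) × (Fin m → ℝ)} {L : Ω → Fin 2 → ℝ} (hZ : Measurable Z)
    (hL : Measurable L) : Measurable fun ω => step ν d A B Γ (Z ω) (L ω) :=
  Measurable.comp (g := fun p : ((Fin 2 → ℝ) × (Fin m → ℝ)) × (Fin 2 → ℝ) => step ν d A B Γ p.1 p.2)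
    (f := fun ω => (Z ω, L ω)) (measurable_step ν d A B Γ) (hZ.prodMk hL)

/-- The index `t - 1` is the point: the state at time `t` uses only earlier inputs, hence is
independent of the innovation at time `t`. -/
theorem measurable_approx {Ω : Type*} [MeasurableSpace Ω] (f : Filtration ℤ ‹MeasurableSpace Ω›)
    {Z : ℤ → Ω → (Fin 2 → ℝ) × (Fin m → ℝ)} (hZ : Adapted f Z) (n : ℕ) (t : ℤ) :
    Measurable[f (t - 1)] fun ω => approx ν d A B Γ n (fun s => Z s ω) t := by
  induction n generalizing t with
  | zero => exact @measurable_const _ _ _ (f (t - 1)) 0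
  | succ n ih =>
    exact @measurable_step_comp m ν d A B Γ Ω (f (t - 1)) _ _ (hZ (t - 1))
      ((ih (t - 1)).mono (f.mono (by omega)) le_rfl)

theorem measurable_latentLimit_of_approx {Ω : Type*} {mΩ : MeasurableSpace Ω}
    {Z : Ω → ℤ → (Fin 2 → ℝ) × (Fin m → ℝ)} {t : ℤ}
    (h : ∀ n, Measurable fun ω => approx ν d A B Γ n (Z ω) t) :
    Measurable fun ω => latentLimit ν d A B Γ (Z ω) t :=
  measurable_pi_lambda _ fun i => Measurable.ennreal_toReal <| Measurable.iSup fun n =>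
    ((measurable_pi_apply i).comp (h n)).ennreal_ofReal

theorem measurable_latentLimit {Ω : Type*} [MeasurableSpace Ω]
    (f : Filtration ℤ ‹MeasurableSpace Ω›)
    {Z : ℤ → Ω → (Fin 2 → ℝ) × (Fin m → ℝ)} (hZ : Adapted f Z) (t : ℤ) :
    Measurable[f (t - 1)] fun ω => latentLimit ν d A B Γ (fun s => Z s ω) t :=
  @measurable_latentLimit_of_approx m ν d A B Γ Ω (f (t - 1)) _ _ fun n =>
    measurable_approx ν d A B Γ f hZ n t

theorem measurable_obs_comp {Ω : Type*} {mΩ : MeasurableSpace Ω} {L : Ω → Fin 2 → ℝ}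
    {Z : Ω → (Fin 2 → ℝ) × (Fin m → ℝ)} (hL : Measurable L) (hZ : Measurable Z) :
    Measurable fun ω => obs ν (L ω) (Z ω).1 :=
  (measurable_obs ν).comp (hL.prodMk hZ.fst)

theorem measurable_obsLimit {Ω : Type*} [MeasurableSpace Ω]
    (f : Filtration ℤ ‹MeasurableSpace Ω›)
    {Z : ℤ → Ω → (Fin 2 → ℝ) × (Fin m → ℝ)} (hZ : Adapted f Z) (t : ℤ) :
    Measurable[f t] fun ω => obsLimit ν d A B Γ (fun s => Z s ω) t :=
  @measurable_obs_comp m ν Ω (f t) _ _ ((measurable_latentLimit ν d A B Γ f hZ t).mono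
    (f.mono (by omega)) le_rfl) (hZ t)

theorem measurable_affine_comp {Ω : Type*} {mΩ : MeasurableSpace Ω} {Y : Ω → ℝ × ℕ}
    {L : Ω → Fin 2 → ℝ} {W : Ω → Fin m → ℝ} (hY : Measurable Y) (hL : Measurable L)
    (hW : Measurable W) : Measurable fun ω =>
      d + B.mulVec (L ω) + A.mulVec (obsTransform (Y ω)) + Γ.mulVec (W ω) :=
  ((measurable_const.add ((measurable_mulVec B).comp hL)).add
    ((measurable_mulVec A).comp (measurable_obsTransform.comp hY))).add
    ((measurable_mulVec Γ).comp hW)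

variable {ν d A B Γ}

theorem approx_nonneg (hd : ∀ i, 0 ≤ d i) (hA : ∀ i j, 0 ≤ A i j) (hB : ∀ i j, 0 ≤ B i j)
    {z : ℤ → (Fin 2 → ℝ) × (Fin m → ℝ)} (hz : ∀ t i, 0 ≤ Γ.mulVec (z t).2 i) (n : ℕ) (t : ℤ)
    (i : Fin 2) : 0 ≤ approx ν d A B Γ n z t i := by
  induction n generalizing t i with
  | zero => exact le_rfl
  | succ n ih => exact step_nonneg hd hA hB (hz _) (ih _) i

/-- Any nonnegative solution along an input dominates the approximations. -/
theorem approx_le_of_step (hd : ∀ i, 0 ≤ d i) (hA : ∀ i j, 0 ≤ A i j) (hB : ∀ i j, 0 ≤ B i j)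
    {z : ℤ → (Fin 2 → ℝ) × (Fin m → ℝ)} (hz : ∀ t i, 0 ≤ Γ.mulVec (z t).2 i)
    (hu : ∀ t i, (z t).1 i < 1) {l : ℤ → Fin 2 → ℝ} (hl : ∀ t i, 0 ≤ l t i)
    (hstep : ∀ t, l t = step ν d A B Γ (z (t - 1)) (l (t - 1))) (n : ℕ) (t : ℤ) (i : Fin 2) :
    approx ν d A B Γ n z t i ≤ l t i := by
  induction n generalizing t i with
  | zero => exact hl t i
  | succ n ih =>
    rw [hstep t]
    exact step_mono hA hB (hu _) (approx_nonneg hd hA hB hz n _) (ih _) i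

/-- No finiteness assumption is needed, since the solution itself bounds the supremum. -/
theorem latentLimit_le_of_step (hd : ∀ i, 0 ≤ d i) (hA : ∀ i j, 0 ≤ A i j) (hB : ∀ i j, 0 ≤ B i j)
    {z : ℤ → (Fin 2 → ℝ) × (Fin m → ℝ)} (hz : ∀ t i, 0 ≤ Γ.mulVec (z t).2 i)
    (hu : ∀ t i, (z t).1 i < 1) {l : ℤ → Fin 2 → ℝ} (hl : ∀ t i, 0 ≤ l t i)
    (hstep : ∀ t, l t = step ν d A B Γ (z (t - 1)) (l (t - 1))) (t : ℤ) (i : Fin 2) :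
    latentLimit ν d A B Γ z t i ≤ l t i :=
  ENNReal.toReal_le_of_le_ofReal (hl t i) <| iSup_le fun n =>
    ENNReal.ofReal_le_ofReal (approx_le_of_step hd hA hB hz hu hl hstep n t i)

/-- The start `0` lies below the first iterate, and the monotone step propagates this order. -/
theorem approx_mono (hd : ∀ i, 0 ≤ d i) (hA : ∀ i j, 0 ≤ A i j) (hB : ∀ i j, 0 ≤ B i j)
    {z : ℤ → (Fin 2 → ℝ) × (Fin m → ℝ)} (hz : ∀ t i, 0 ≤ Γ.mulVec (z t).2 i)
    (hu : ∀ t i, (z t).1 i < 1) (t : ℤ) (i : Fin 2) :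
    Monotone fun n => approx ν d A B Γ n z t i := by
  refine monotone_nat_of_le_succ fun n => ?_
  induction n generalizing t i with
  | zero => exact approx_nonneg hd hA hB hz 1 t i
  | succ n ih => exact step_mono hA hB (hu _) (approx_nonneg hd hA hB hz n _) (fun i => ih _ i) i

/-- Finiteness matters because `toReal` sends `⊤` to `0`. -/
theorem ofReal_latentLimit {z : ℤ → (Fin 2 → ℝ) × (Fin m → ℝ)} {t : ℤ} {i : Fin 2}
    (hfin : ⨆ n, ENNReal.ofReal (approx ν d A B Γ n z t i) ≠ ⊤) :
    ENNReal.ofReal (latentLimit ν d A B Γ z t i) =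
      ⨆ n, ENNReal.ofReal (approx ν d A B Γ n z t i) := ENNReal.ofReal_toReal hfin

theorem approx_le_latentLimit {z : ℤ → (Fin 2 → ℝ) × (Fin m → ℝ)} {t : ℤ} {i : Fin 2}
    (hfin : ⨆ n, ENNReal.ofReal (approx ν d A B Γ n z t i) ≠ ⊤) (n : ℕ) :
    approx ν d A B Γ n z t i ≤ latentLimit ν d A B Γ z t i := by
  have h0 : 0 ≤ latentLimit ν d A B Γ z t i := ENNReal.toReal_nonneg
  rw [← ENNReal.ofReal_le_ofReal_iff h0, ofReal_latentLimit hfin]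
  exact le_iSup (fun n => ENNReal.ofReal (approx ν d A B Γ n z t i)) n

theorem tendsto_approx (hd : ∀ i, 0 ≤ d i) (hA : ∀ i j, 0 ≤ A i j) (hB : ∀ i j, 0 ≤ B i j)
    {z : ℤ → (Fin 2 → ℝ) × (Fin m → ℝ)} (hz : ∀ t i, 0 ≤ Γ.mulVec (z t).2 i)
    (hu : ∀ t i, (z t).1 i < 1) {t : ℤ}
    (hfin : ∀ i, ⨆ n, ENNReal.ofReal (approx ν d A B Γ n z t i) ≠ ⊤) :
    Tendsto (fun n => approx ν d A B Γ n z t) atTop (𝓝 (latentLimit ν d A B Γ z t)) := by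
  rw [tendsto_pi_nhds]
  intro i
  have h : Tendsto (fun n => ENNReal.ofReal (approx ν d A B Γ n z t i)) atTop
      (𝓝 (⨆ n, ENNReal.ofReal (approx ν d A B Γ n z t i))) :=
    tendsto_atTop_iSup fun a b hab => ENNReal.ofReal_le_ofReal (approx_mono hd hA hB hz hu t i hab)
  refine ((ENNReal.tendsto_toReal (hfin i)).comp h).congr fun n => ?_
  exact ENNReal.toReal_ofReal (approx_nonneg hd hA hB hz n t i)

theorem latentLimit_eq_step (hd : ∀ i, 0 ≤ d i) (hA : ∀ i j, 0 ≤ A i j) (hB : ∀ i j, 0 ≤ B i j)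
    {z : ℤ → (Fin 2 → ℝ) × (Fin m → ℝ)} (hz : ∀ t i, 0 ≤ Γ.mulVec (z t).2 i)
    (hu : ∀ t i, (z t).1 i < 1)
    (hfin : ∀ t i, ⨆ n, ENNReal.ofReal (approx ν d A B Γ n z t i) ≠ ⊤) (t : ℤ) :
    latentLimit ν d A B Γ z t =
      step ν d A B Γ (z (t - 1)) (latentLimit ν d A B Γ z (t - 1)) := by
  have h1 := (tendsto_approx hd hA hB hz hu (hfin t)).comp (tendsto_add_atTop_nat 1)
  have h2 := tendsto_step (ν := ν) (d := d) (A := A) (B := B) (Γ := Γ) (z := z (t - 1))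
    (fun n => approx_nonneg hd hA hB hz n (t - 1))
    (fun n i => approx_le_latentLimit (hfin (t - 1) i) n)
    (tendsto_approx hd hA hB hz hu (hfin (t - 1))) (hu _)
  exact tendsto_nhds_unique h1 h2

end Construction

/-! ### Stationary processes and their factors -/

section Stationary

variable {Ω S : Type*} [MeasurableSpace Ω] [MeasurableSpace S] {P : Measure Ω}

theorem measurable_shift : Measurable (shift : (ℤ → S) → ℤ → S) :=
  measurable_pi_lambda _ fun _ => measurable_pi_apply _

theorem IsStationary.map_eq {Z : ℤ → Ω → S} (h : IsStationary P Z) (s t : ℤ) :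
    P.map (Z s) = P.map (Z t) := by
  have hm : AEMeasurable (fun ω t => Z t ω) P := aemeasurable_pi_lambda _ h.1
  have hmap : ∀ t, P.map (Z t) = (pathLaw P Z).map (fun z => z t) := fun t => by
    rw [pathLaw, AEMeasurable.map_map_of_aemeasurable (measurable_pi_apply t).aemeasurable hm]
    rfl
  have hsucc : ∀ t, P.map (Z (t + 1)) = P.map (Z t) := fun t => by
    rw [hmap t]
    conv_rhs => rw [← h.2.map_eq]
    rw [Measure.map_map (measurable_pi_apply t) measurable_shift, hmap]
    rfl
  have h0 : ∀ t, P.map (Z t) = P.map (Z 0) := fun t => by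
    induction t using Int.induction_on with
    | zero => rfl
    | succ n ih => rw [hsucc, ih]
    | pred n ih => rw [← ih, ← hsucc, sub_add_cancel]
  rw [h0 s, h0 t]

theorem IsStationary.identDistrib {Z : ℤ → Ω → S} (h : IsStationary P Z) (s t : ℤ) :
    IdentDistrib (Z s) (Z t) P P := ⟨h.1 s, h.1 t, h.map_eq s t⟩

theorem measurePreserving_pathLaw_factor {S' : Type*} [MeasurableSpace S'] {Z : ℤ → Ω → S}
    (hZ : ∀ t, AEMeasurable (Z t) P) {Φ : (ℤ → S) → ℤ → S'} (hΦ : Measurable Φ) :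
    MeasurePreserving Φ (pathLaw P Z) (pathLaw P fun t ω => Φ (fun s => Z s ω) t) := by
  refine ⟨hΦ, ?_⟩
  rw [pathLaw, AEMeasurable.map_map_of_aemeasurable hΦ.aemeasurable (aemeasurable_pi_lambda _ hZ)]
  rfl

/-- `Φ` intertwines the two shifts and pushes one path law to the other, and a factor of an ergodic
system is ergodic. -/
theorem IsStationaryErgodic.factor {S' : Type*} [MeasurableSpace S'] {Z : ℤ → Ω → S}
    (h : IsStationaryErgodic P Z) {Φ : (ℤ → S) → ℤ → S'} (hΦ : Measurable Φ)
    (hcomm : ∀ z t, Φ (shift z) t = Φ z (t + 1)) :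
    IsStationaryErgodic P fun t ω => Φ (fun s => Z s ω) t := by
  have hm := measurePreserving_pathLaw_factor h.1 hΦ
  refine ⟨fun t => ?_, hm.ergodic_of_ergodic_semiconj h.2 measurable_shift fun z =>
    funext (hcomm z)⟩
  exact ((measurable_pi_apply t).comp hΦ).comp_aemeasurable (aemeasurable_pi_lambda _ h.1)

theorem IsStationaryErgodic.isStationary {Z : ℤ → Ω → S} (h : IsStationaryErgodic P Z) :
    IsStationary P Z := ⟨h.1, h.2.toMeasurePreserving⟩

end Stationary

/-! ### The model: existence, uniqueness and converse -/

/-- The standing assumptions on the coefficients, the innovation law and the input process. -/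
structure InputConditions {Ω : Type*} [MeasurableSpace Ω] {m : ℕ} (P : Measure Ω) (ν : Measure ℝ)
    (d : Fin 2 → ℝ) (A B : Matrix (Fin 2) (Fin 2) ℝ) (Γ : Matrix (Fin 2) (Fin m) ℝ)
    (U : ℤ → Ω → Fin 2 → ℝ) (X : ℤ → Ω → Fin m → ℝ)
    (hU : ∀ t, Measurable (U t)) (hX : ∀ t, Measurable (X t)) : Prop where
  memLp : MemLp id 2 ν
  mean_zero : ∫ x, x ∂ν = 0
  var_one : Var[id; ν] = 1
  d_nonneg : ∀ i, 0 ≤ d i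
  A_nonneg : ∀ i j, 0 ≤ A i j
  B_nonneg : ∀ i j, 0 ≤ B i j
  copula : IsCopula (P.map (U 1))
  input : AssumptionA1 P U X hU hX
  integrable_covariate : ∀ j, Integrable (fun ω => X 1 ω j) P
  covariate_nonneg : ∀ t, ∀ᵐ ω ∂P, ∀ i, 0 ≤ Γ.mulVec (X t ω) i

theorem adapted_input {Ω : Type*} [MeasurableSpace Ω] {m : ℕ}
    (U : ℤ → Ω → Fin 2 → ℝ) (X : ℤ → Ω → Fin m → ℝ)
    (hU : ∀ t, Measurable (U t)) (hX : ∀ t, Measurable (X t)) :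
    Adapted (inputFiltration U X hU hX) fun t ω => (U t ω, X t ω) := fun t =>
  measurable_iff_comap_le.2 (le_iSup₂_of_le
    (f := fun j (_ : j ≤ t) => MeasurableSpace.comap (fun ω => (U j ω, X j ω)) inferInstance)
    t le_rfl le_rfl)

section Solution

variable {Ω : Type*} [MeasurableSpace Ω] {m : ℕ} {P : Measure Ω} {ν : Measure ℝ}
  {d : Fin 2 → ℝ} {A B : Matrix (Fin 2) (Fin 2) ℝ} {Γ : Matrix (Fin 2) (Fin m) ℝ}
  {U : ℤ → Ω → Fin 2 → ℝ} {X : ℤ → Ω → Fin m → ℝ} {Y : ℤ → Ω → ℝ × ℕ} {lam : ℤ → Ω → Fin 2 → ℝ}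

theorem IsSolution.ae_eq_obs (hs : IsSolution P ν d A B Γ U X Y lam) :
    ∀ᵐ ω ∂P, ∀ t, Y t ω = obs ν (lam t ω) (U t ω) := by
  filter_upwards [hs.garch, hs.ingarch] with ω h1 h2 t
  exact Prod.ext (h1 t) (h2 t)

theorem IsSolution.ae_eq_step (hs : IsSolution P ν d A B Γ U X Y lam) :
    ∀ᵐ ω ∂P, ∀ t, lam t ω = step ν d A B Γ (U (t - 1) ω, X (t - 1) ω) (lam (t - 1) ω) := by
  filter_upwards [hs.ae_eq_obs, hs.latent] with ω h1 h2 t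
  rw [h2 t, h1 (t - 1), step]

end Solution

namespace InputConditions

variable {Ω : Type*} [MeasurableSpace Ω] {m : ℕ} {P : Measure Ω}
  {ν : Measure ℝ}
  {d : Fin 2 → ℝ} {A B : Matrix (Fin 2) (Fin 2) ℝ} {Γ : Matrix (Fin 2) (Fin m) ℝ}
  {U : ℤ → Ω → Fin 2 → ℝ} {X : ℤ → Ω → Fin m → ℝ}
  {hU : ∀ t, Measurable (U t)} {hX : ∀ t, Measurable (X t)}
  {Y : ℤ → Ω → ℝ × ℕ} {lam : ℤ → Ω → Fin 2 → ℝ}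

theorem identDistrib_innovation (h : InputConditions P ν d A B Γ U X hU hX) (s t : ℤ) :
    IdentDistrib (U s) (U t) P P :=
  (h.input.1.isStationary.identDistrib s t).comp measurable_fst

theorem identDistrib_covariate (h : InputConditions P ν d A B Γ U X hU hX) (s t : ℤ) :
    IdentDistrib (X s) (X t) P P :=
  (h.input.1.isStationary.identDistrib s t).comp measurable_snd

theorem ae_covariate_nonneg (h : InputConditions P ν d A B Γ U X hU hX) :
    ∀ᵐ ω ∂P, ∀ t i, 0 ≤ Γ.mulVec (X t ω) i := ae_all_iff.2 h.covariate_nonneg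

theorem indepFun_of_measurable (h : InputConditions P ν d A B Γ U X hU hX) {t : ℤ}
    {L : Ω → Fin 2 → ℝ} (hL : Measurable[inputFiltration U X hU hX (t - 1)] L) :
    IndepFun L (U t) P :=
  (indep_of_indep_of_le_right (h.input.2 t) (measurable_iff_comap_le.1 hL)).symm

theorem measurable_latentLimit_input (U : ℤ → Ω → Fin 2 → ℝ) (X : ℤ → Ω → Fin m → ℝ)
    (hU : ∀ t, Measurable (U t)) (hX : ∀ t, Measurable (X t)) (t : ℤ) :
    Measurable fun ω => latentLimit ν d A B Γ (fun s => (U s ω, X s ω)) t :=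
  (measurable_latentLimit ν d A B Γ _ (adapted_input U X hU hX) t).mono
    (Filtration.le _ _) le_rfl

theorem copula_at (h : InputConditions P ν d A B Γ U X hU hX) (t : ℤ) :
    IsCopula (P.map (U t)) := by
  rw [(h.identDistrib_innovation t 1).map_eq]
  exact h.copula

theorem integrable_covariate_at (h : InputConditions P ν d A B Γ U X hU hX) (t : ℤ) (j : Fin m) :
    Integrable (fun ω => X t ω j) P :=
  ((h.identDistrib_covariate t 1).comp (measurable_pi_apply j)).integrable_iff.2
    (h.integrable_covariate j)

theorem mean_covariate (h : InputConditions P ν d A B Γ U X hU hX) (t : ℤ) :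
    mean P (X t) = mean P (X 1) :=
  funext fun j => ((h.identDistrib_covariate t 1).comp (measurable_pi_apply j)).integral_eq

theorem ae_innovation_lt_one (h : InputConditions P ν d A B Γ U X hU hX) :
    ∀ᵐ ω ∂P, ∀ t i, U t ω i < 1 := by
  refine ae_all_iff.2 fun t => ae_all_iff.2 fun i => ?_
  have hm : Measurable fun ω => U t ω i := (measurable_pi_apply i).comp (hU t)
  have hmap : P.map (fun ω => U t ω i) = volume.restrict (Icc (0 : ℝ) 1) := by
    rw [← h.copula_at t i, Measure.map_map (measurable_pi_apply i) (hU t)]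
    rfl
  refine ae_of_ae_map hm.aemeasurable (p := fun u => u < 1) ?_
  rw [hmap]
  exact ae_mem_Ioo_uniform.mono fun u hu => hu.2

theorem isStationaryErgodic_limit (h : InputConditions P ν d A B Γ U X hU hX) :
    IsStationaryErgodic P (fun t ω => (obsLimit ν d A B Γ (fun s => (U s ω, X s ω)) t,
      latentLimit ν d A B Γ (fun s => (U s ω, X s ω)) t, X t ω)) := by
  have hid : ∀ t : ℤ, Measurable fun z : ℤ → (Fin 2 → ℝ) × (Fin m → ℝ) => z t := fun t =>
    measurable_pi_apply t
  have hL : ∀ t, Measurable fun z : ℤ → (Fin 2 → ℝ) × (Fin m → ℝ) =>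
      latentLimit ν d A B Γ z t := fun t =>
    -- On path space plain measurability suffices, so the constant filtration serves.
    measurable_latentLimit ν d A B Γ (Filtration.const ℤ MeasurableSpace.pi le_rfl)
      (Z := fun t (z : ℤ → (Fin 2 → ℝ) × (Fin m → ℝ)) => z t) hid t
  refine h.input.1.factor (Φ := fun z t =>
    (obsLimit ν d A B Γ z t, latentLimit ν d A B Γ z t, (z t).2)) ?_ fun z t => ?_
  · exact measurable_pi_lambda _ fun t =>
      (measurable_obs_comp ν (hL t) (hid t)).prodMk ((hL t).prodMk (hid t).snd)
  · simp only [obsLimit, latentLimit_shift, shift]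

/-- Adaptedness places `lam t` only in the σ-algebra at time `t`, which contains `U t`. The latent
equation shows that it agrees almost surely with a variable measurable at time `t - 1`. -/
theorem indepFun_solution (h : InputConditions P ν d A B Γ U X hU hX)
    (hs : IsStationaryIntegrableSolution P ν d A B Γ U X hU hX Y lam) (t : ℤ) :
    IndepFun (lam t) (U t) P := by
  have hY : Measurable[inputFiltration U X hU hX (t - 1)] fun ω => Y (t - 1) ω :=
    measurable_fst.comp (hs.adapted (t - 1))
  have hl : Measurable[inputFiltration U X hU hX (t - 1)] fun ω => lam (t - 1) ω :=
    measurable_snd.comp (hs.adapted (t - 1))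
  have hx : Measurable[inputFiltration U X hU hX (t - 1)] fun ω => X (t - 1) ω :=
    measurable_snd.comp (adapted_input U X hU hX (t - 1))
  have hm : Measurable[inputFiltration U X hU hX (t - 1)] fun ω => d + B.mulVec (lam (t - 1) ω)
      + A.mulVec (obsTransform (Y (t - 1) ω)) + Γ.mulVec (X (t - 1) ω) :=
    @measurable_affine_comp m d A B Γ Ω (inputFiltration U X hU hX (t - 1)) _ _ _ hY hl hx
  refine (h.indepFun_of_measurable hm).congr ?_ EventuallyEq.rfl
  exact hs.solution.latent.mono fun ω hω => (hω t).symm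

variable {w : Fin 2 → ℝ} [IsProbabilityMeasure P] [IsProbabilityMeasure ν]

theorem integrable_and_mean_approx (h : InputConditions P ν d A B Γ U X hU hX) (n : ℕ) (t : ℤ) :
    (∀ i, Integrable (fun ω => approx ν d A B Γ n (fun s => (U s ω, X s ω)) t i) P) ∧
      mean P (fun ω => approx ν d A B Γ n (fun s => (U s ω, X s ω)) t) =
        (fun x => (d + Γ.mulVec (mean P (X 1))) + (A + B).mulVec x)^[n] 0 := by
  induction n generalizing t with
  | zero =>
    refine ⟨fun i => integrable_zero _ _ _, funext fun i => ?_⟩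
    simp [mean, approx]
  | succ n ih =>
    have hm := measurable_approx ν d A B Γ _ (adapted_input U X hU hX) n (t - 1)
    obtain ⟨h1, h2⟩ := integrable_and_mean_step d A B Γ h.memLp h.mean_zero h.var_one
      (hm.mono (Filtration.le _ _) le_rfl).aemeasurable (hU (t - 1)) (h.copula_at (t - 1))
      (h.indepFun_of_measurable hm)
      (h.ae_covariate_nonneg.mono fun ω hω i =>
        approx_nonneg h.d_nonneg h.A_nonneg h.B_nonneg hω n (t - 1) i)
      (ih (t - 1)).1 (h.integrable_covariate_at (t - 1))
    refine ⟨h1, ?_⟩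
    rw [Function.iterate_succ_apply', ← (ih (t - 1)).2, ← h.mean_covariate (t - 1)]
    exact h2

/-- Monotone convergence: the means of the approximations are the affine iterates from `0`, which
tend to the fixed point `w`. -/
theorem lintegral_iSup_approx (h : InputConditions P ν d A B Γ U X hU hX)
    (hρ : matrixSpectralRadius (A + B) < 1)
    (hw : w = (d + Γ.mulVec (mean P (X 1))) + (A + B).mulVec w) (t : ℤ) (i : Fin 2) :
    ∫⁻ ω, ⨆ n, ENNReal.ofReal (approx ν d A B Γ n (fun s => (U s ω, X s ω)) t i) ∂P =
      ENNReal.ofReal (w i) := by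
  have hint := fun n => (h.integrable_and_mean_approx n t).1 i
  have hmono : ∀ᵐ ω ∂P, Monotone fun n =>
      ENNReal.ofReal (approx ν d A B Γ n (fun s => (U s ω, X s ω)) t i) := by
    filter_upwards [h.ae_covariate_nonneg, h.ae_innovation_lt_one] with ω h1 h2 a b hab
    exact ENNReal.ofReal_le_ofReal
      (approx_mono h.d_nonneg h.A_nonneg h.B_nonneg h1 h2 t i hab)
  have hlim := lintegral_tendsto_of_tendsto_of_monotone
    (fun n => (hint n).aestronglyMeasurable.aemeasurable.ennreal_ofReal) hmono
    (hmono.mono fun ω hω => tendsto_atTop_iSup hω)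
  have hv := tendsto_pi_nhds.1 (tendsto_affine_iterate hρ hw (v := fun n =>
    (fun x => (d + Γ.mulVec (mean P (X 1))) + (A + B).mulVec x)^[n] 0)
    fun n => Function.iterate_succ_apply' _ _ _) i
  refine tendsto_nhds_unique hlim ((ENNReal.tendsto_ofReal hv).congr fun n => ?_)
  rw [← (h.integrable_and_mean_approx n t).2, mean, ofReal_integral_eq_lintegral_ofReal (hint n)]
  exact h.ae_covariate_nonneg.mono fun ω hω =>
    approx_nonneg h.d_nonneg h.A_nonneg h.B_nonneg hω n t i

theorem ae_iSup_approx_ne_top (h : InputConditions P ν d A B Γ U X hU hX)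
    (hρ : matrixSpectralRadius (A + B) < 1) :
    ∀ᵐ ω ∂P, ∀ t i,
      ⨆ n, ENNReal.ofReal (approx ν d A B Γ n (fun s => (U s ω, X s ω)) t i) ≠ ⊤ := by
  obtain ⟨w, hw⟩ := exists_affine_fixed hρ (d + Γ.mulVec (mean P (X 1)))
  refine ae_all_iff.2 fun t => ae_all_iff.2 fun i => ?_
  have hm : AEMeasurable (fun ω =>
      ⨆ n, ENNReal.ofReal (approx ν d A B Γ n (fun s => (U s ω, X s ω)) t i)) P :=
    AEMeasurable.iSup fun n =>
      ((h.integrable_and_mean_approx n t).1 i).aestronglyMeasurable.aemeasurable.ennreal_ofReal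
  refine (ae_lt_top' hm ?_).mono fun ω hω => hω.ne
  rw [h.lintegral_iSup_approx hρ hw]
  exact ENNReal.ofReal_ne_top

theorem lintegral_latentLimit (h : InputConditions P ν d A B Γ U X hU hX)
    (hρ : matrixSpectralRadius (A + B) < 1)
    (hw : w = (d + Γ.mulVec (mean P (X 1))) + (A + B).mulVec w) (t : ℤ) (i : Fin 2) :
    ∫⁻ ω, ENNReal.ofReal (latentLimit ν d A B Γ (fun s => (U s ω, X s ω)) t i) ∂P =
      ENNReal.ofReal (w i) := by
  rw [← h.lintegral_iSup_approx hρ hw t i]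
  exact lintegral_congr_ae ((h.ae_iSup_approx_ne_top hρ).mono fun ω hω =>
    ofReal_latentLimit (hω t i))

theorem integrable_latentLimit (h : InputConditions P ν d A B Γ U X hU hX)
    (hρ : matrixSpectralRadius (A + B) < 1) (t : ℤ) (i : Fin 2) :
    Integrable (fun ω => latentLimit ν d A B Γ (fun s => (U s ω, X s ω)) t i) P := by
  obtain ⟨w, hw⟩ := exists_affine_fixed hρ (d + Γ.mulVec (mean P (X 1)))
  have hm : Measurable fun ω => latentLimit ν d A B Γ (fun s => (U s ω, X s ω)) t i :=
    (measurable_pi_apply i).comp (measurable_latentLimit_input U X hU hX t)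
  refine (lintegral_ofReal_ne_top_iff_integrable hm.aestronglyMeasurable
    (ae_of_all _ fun ω => ENNReal.toReal_nonneg)).1 ?_
  rw [h.lintegral_latentLimit hρ hw]
  exact ENNReal.ofReal_ne_top

theorem ae_latentLimit_eq_step (h : InputConditions P ν d A B Γ U X hU hX)
    (hρ : matrixSpectralRadius (A + B) < 1) :
    ∀ᵐ ω ∂P, ∀ t, latentLimit ν d A B Γ (fun s => (U s ω, X s ω)) t =
      step ν d A B Γ (U (t - 1) ω, X (t - 1) ω)
        (latentLimit ν d A B Γ (fun s => (U s ω, X s ω)) (t - 1)) := by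
  filter_upwards [h.ae_covariate_nonneg, h.ae_innovation_lt_one, h.ae_iSup_approx_ne_top hρ]
    with ω h1 h2 h3 t
  exact latentLimit_eq_step h.d_nonneg h.A_nonneg h.B_nonneg h1 h2 h3 t

theorem integrable_obsTransform_obsLimit (h : InputConditions P ν d A B Γ U X hU hX)
    (hρ : matrixSpectralRadius (A + B) < 1) (t : ℤ) (i : Fin 2) :
    Integrable (fun ω => obsTransform (obsLimit ν d A B Γ (fun s => (U s ω, X s ω)) t) i) P :=
  (integrable_and_mean_obsTransform h.memLp h.mean_zero h.var_one
    (measurable_latentLimit_input U X hU hX t).aemeasurable (hU t) (h.copula_at t)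
    (h.indepFun_of_measurable (measurable_latentLimit ν d A B Γ _ (adapted_input U X hU hX) t))
    (ae_of_all _ fun _ _ => ENNReal.toReal_nonneg) (h.integrable_latentLimit hρ t)).1 i

theorem isStationaryIntegrableSolution_limit (h : InputConditions P ν d A B Γ U X hU hX)
    (hρ : matrixSpectralRadius (A + B) < 1) :
    IsStationaryIntegrableSolution P ν d A B Γ U X hU hX
      (fun t ω => obsLimit ν d A B Γ (fun s => (U s ω, X s ω)) t)
      (fun t ω => latentLimit ν d A B Γ (fun s => (U s ω, X s ω)) t) where
  solution :=
    { latent_nonneg := ae_of_all _ fun ω t i => ENNReal.toReal_nonneg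
      garch := ae_of_all _ fun ω t => rfl
      ingarch := ae_of_all _ fun ω t => rfl
      latent := h.ae_latentLimit_eq_step hρ }
  stationary := by
    have hs := h.isStationaryErgodic_limit (ν := ν)
    -- Dropping the covariate is a factor map, so stationarity descends from the ergodic triple.
    have hΦ : Measurable fun (z : ℤ → (ℝ × ℕ) × (Fin 2 → ℝ) × (Fin m → ℝ)) (t : ℤ) =>
        ((z t).1, (z t).2.1) := measurable_pi_lambda _ fun t => by fun_prop
    exact (hs.factor hΦ fun z t => rfl).isStationary
  adapted := fun t =>
    (measurable_obsLimit ν d A B Γ _ (adapted_input U X hU hX) t).prodMk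
      ((measurable_latentLimit ν d A B Γ _ (adapted_input U X hU hX) t).mono
        ((inputFiltration U X hU hX).mono (by omega)) le_rfl)
  integrable_fst := fun t => by
    have hm : Measurable fun ω => (obsLimit ν d A B Γ (fun s => (U s ω, X s ω)) t).1 :=
      ((measurable_obsLimit ν d A B Γ _ (adapted_input U X hU hX) t).mono
        (Filtration.le _ _) le_rfl).fst
    -- The squared observation is integrable, and on a probability space square integrability gives
    -- integrability.
    exact ((memLp_two_iff_integrable_sq hm.aestronglyMeasurable).2
      (h.integrable_obsTransform_obsLimit hρ t 0)).integrable one_le_two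
  integrable_snd := fun t => h.integrable_obsTransform_obsLimit hρ t 1
  integrable_latent := h.integrable_latentLimit hρ

/-- The expectation of a stationary integrable solution is a fixed point. -/
theorem mean_solution (h : InputConditions P ν d A B Γ U X hU hX)
    (hs : IsStationaryIntegrableSolution P ν d A B Γ U X hU hX Y lam) (t : ℤ) :
    mean P (lam t) = (d + Γ.mulVec (mean P (X 1))) + (A + B).mulVec (mean P (lam t)) := by
  have hm : ∀ t, AEMeasurable (lam t) P := fun t => (hs.stationary.1 t).snd
  have hstat : mean P (lam (t + 1)) = mean P (lam t) := funext fun i =>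
    ((hs.stationary.identDistrib (t + 1) t).comp
      ((measurable_pi_apply i).comp measurable_snd)).integral_eq
  have hstep := (integrable_and_mean_step d A B Γ h.memLp h.mean_zero h.var_one (hm t) (hU t)
    (h.copula_at t) (h.indepFun_solution hs t)
    (hs.solution.latent_nonneg.mono fun ω hω i => hω t i) (hs.integrable_latent t)
    (h.integrable_covariate_at t)).2
  rw [← h.mean_covariate t, ← hstep, ← hstat]
  funext i
  refine integral_congr_ae (hs.solution.ae_eq_step.mono fun ω hω => ?_)
  have := congrFun (hω (t + 1)) i
  rwa [add_sub_cancel_right] at this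

theorem ae_solution_eq_limit (h : InputConditions P ν d A B Γ U X hU hX)
    (hρ : matrixSpectralRadius (A + B) < 1)
    (hs : IsStationaryIntegrableSolution P ν d A B Γ U X hU hX Y lam) :
    ∀ᵐ ω ∂P, ∀ t, Y t ω = obsLimit ν d A B Γ (fun s => (U s ω, X s ω)) t ∧
      lam t ω = latentLimit ν d A B Γ (fun s => (U s ω, X s ω)) t := by
  have hlim := h.isStationaryIntegrableSolution_limit hρ
  have hmean : ∀ t, mean P (fun ω => latentLimit ν d A B Γ (fun s => (U s ω, X s ω)) t) =
      mean P (lam t) := fun t =>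
    eq_of_affine_fixed hρ (h.mean_solution hlim t) (h.mean_solution hs t)
  have hle : ∀ᵐ ω ∂P, ∀ t i,
      latentLimit ν d A B Γ (fun s => (U s ω, X s ω)) t i ≤ lam t ω i := by
    filter_upwards [h.ae_covariate_nonneg, h.ae_innovation_lt_one, hs.solution.latent_nonneg,
      hs.solution.ae_eq_step] with ω h1 h2 h3 h4 t i
    exact latentLimit_le_of_step (z := fun s => (U s ω, X s ω)) (l := fun s => lam s ω)
      h.d_nonneg h.A_nonneg h.B_nonneg h1 h2 h3 h4 t i
  have heq : ∀ᵐ ω ∂P, ∀ t i,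
      latentLimit ν d A B Γ (fun s => (U s ω, X s ω)) t i = lam t ω i := by
    refine ae_all_iff.2 fun t => ae_all_iff.2 fun i => ?_
    have hle' : (fun ω => latentLimit ν d A B Γ (fun s => (U s ω, X s ω)) t i)
        ≤ᵐ[P] fun ω => lam t ω i := hle.mono fun ω hω => hω t i
    have hint := congrFun (hmean t) i
    simp only [mean] at hint
    -- Ordered integrable functions with equal integrals coincide almost everywhere.
    exact (integral_eq_iff_of_ae_le (h.integrable_latentLimit hρ t i)
      (hs.integrable_latent t i) hle').1 hint
  filter_upwards [heq, hs.solution.ae_eq_obs] with ω h1 h2 t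
  have hl : lam t ω = latentLimit ν d A B Γ (fun s => (U s ω, X s ω)) t :=
    funext fun i => (h1 t i).symm
  exact ⟨by rw [h2 t, hl, obsLimit], hl⟩

theorem matrixSpectralRadius_lt_one_of_solution (h : InputConditions P ν d A B Γ U X hU hX)
    (hd : ∀ i, 0 < d i) (hs : IsStationaryIntegrableSolution P ν d A B Γ U X hU hX Y lam) :
    matrixSpectralRadius (A + B) < 1 := by
  have hAB : ∀ i j, 0 ≤ (A + B) i j := fun i j => add_nonneg (h.A_nonneg i j) (h.B_nonneg i j)
  have hg : ∀ i, 0 ≤ Γ.mulVec (mean P (X 1)) i := fun i => by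
    rw [← mean_mulVec Γ h.integrable_covariate]
    exact integral_nonneg_of_ae ((h.covariate_nonneg 1).mono fun ω hω => hω i)
  have h0 : ∀ i, 0 ≤ mean P (lam 0) i := fun i =>
    integral_nonneg_of_ae (hs.solution.latent_nonneg.mono fun ω hω => hω 0 i)
  have hfix : ∀ i, mean P (lam 0) i =
      (d i + Γ.mulVec (mean P (X 1)) i) + (A + B).mulVec (mean P (lam 0)) i := fun i =>
    congrFun (h.mean_solution hs 0) i
  refine matrixSpectralRadius_lt_one_of_mulVec_lt hAB (x := mean P (lam 0)) (fun i => ?_)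
    fun i => ?_
  -- Positivity of the mean comes from the positive intercept `d`, and so does the strict decrease
  -- in the next goal.
  · linarith [hfix i, hd i, hg i, mulVec_nonneg hAB h0 i]
  · linarith [hfix i, hd i, hg i]

end InputConditions

end GAIN
theorem mainTheorem6 {Ω : Type*} [MeasurableSpace Ω] (P : Measure Ω) [IsProbabilityMeasure P]
    (ν : Measure ℝ) [IsProbabilityMeasure ν] (hν : MemLp id 2 ν)
    (hν_mean : ∫ x, x ∂ν = 0) (hν_var : Var[id; ν] = 1)
    {m : ℕ} (d : Fin 2 → ℝ) (A B : Matrix (Fin 2) (Fin 2) ℝ) (Γ : Matrix (Fin 2) (Fin m) ℝ)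
    (hd : ∀ i, 0 ≤ d i) (hA : ∀ i j, 0 ≤ A i j) (hB : ∀ i j, 0 ≤ B i j)
    (U : ℤ → Ω → Fin 2 → ℝ) (X : ℤ → Ω → Fin m → ℝ)
    (hU : ∀ t, Measurable (U t)) (hX : ∀ t, Measurable (X t))
    (hcop : GAIN.IsCopula (P.map (U 1)))
    (hA1 : GAIN.AssumptionA1 P U X hU hX)
    (hXint : ∀ j, Integrable (fun ω => X 1 ω j) P)
    (hΓX : ∀ t, ∀ᵐ ω ∂P, ∀ i, 0 ≤ Γ.mulVec (X t ω) i) :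
    (GAIN.matrixSpectralRadius (A + B) < 1 →
      ∃ (Y : ℤ → Ω → ℝ × ℕ) (lam : ℤ → Ω → Fin 2 → ℝ),
        GAIN.IsStationaryIntegrableSolution P ν d A B Γ U X hU hX Y lam ∧
        (∀ (Y' : ℤ → Ω → ℝ × ℕ) (lam' : ℤ → Ω → Fin 2 → ℝ),
          GAIN.IsStationaryIntegrableSolution P ν d A B Γ U X hU hX Y' lam' →
            ∀ᵐ ω ∂P, ∀ t, Y' t ω = Y t ω ∧ lam' t ω = lam t ω) ∧
        GAIN.IsStationaryErgodic P (fun t ω => (Y t ω, lam t ω, X t ω))) ∧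
    ((∀ i, 0 < d i) →
      (∃ (Y : ℤ → Ω → ℝ × ℕ) (lam : ℤ → Ω → Fin 2 → ℝ),
        GAIN.IsStationaryIntegrableSolution P ν d A B Γ U X hU hX Y lam) →
      GAIN.matrixSpectralRadius (A + B) < 1) := by
  have h : GAIN.InputConditions P ν d A B Γ U X hU hX :=
    ⟨hν, hν_mean, hν_var, hd, hA, hB, hcop, hA1, hXint, hΓX⟩
  refine ⟨fun hρ => ⟨_, _, h.isStationaryIntegrableSolution_limit hρ,
    fun Y' lam' hs => h.ae_solution_eq_limit hρ hs, h.isStationaryErgodic_limit⟩, ?_⟩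
  rintro hd' ⟨Y, lam, hs⟩
  exact h.matrixSpectralRadius_lt_one_of_solution hd' hs
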